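/- **High probability global stability bound.** Let $\mathbb X\subseteq\mathbb R^n$, $\mathbb U\subseteq\mathbb R^m$, $\mathbb W\subseteq\mathbb R^n$, $\mathbb S\subseteq\mathbb R^q$, let $f:\mathbb X\times\mathbb U\to\mathbb R^n$, $\psi:\mathbb X\times\mathbb U\to\mathbb R^d$, $\alpha:\mathbb X\times\mathbb S\times\mathbb R^{d\times n}\to\mathbb U$, $\theta_*\in\mathbb R^{d\times n}$, and put $g(x,u,w)=f(x,u)+\theta_*^\top\psi(x,u)+w$, where $g(x,u,w)\in\mathbb X$ for all $x\in\mathbb X$, $u\in\mathbb U$ and all $w\in\mathbb W\cup\{0\}$. Let $\gamma>0$, $\vartheta_0\in\mathbb R^{d\times n}$, and let $\{W(t)\}_{t\ge1}$, $\{S(t)\}_{t\ge0}$ be random sequences with values in $\mathbb W$, $\mathbb S$. For $x_0\in\mathbb X$ consider the adaptive closed loop $X(0)=x_0$, $U(t)=\alpha(X(t),S(t),\hat\theta(t-1))$, $X(t+1)=g(X(t),U(t),W(t+1))$ for $t\ge0$, where $\hat\theta(-1)=\hat\theta(0)=\vartheta_0$ and, for $t\ge1$, $\hat\theta(t)$ minimises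 $$\sum_{s=1}^t\big|X(s)-\theta^\top\psi(X(s-1),U(s-1))-f(X(s-1),U(s-1))\big|^2+\gamma|\theta|_F^2$$ over $\theta\in\mathbb R^{d\times n}$. Here $|\cdot|$ is the Euclidean norm of vectors and the induced 2-norm of matrices, and $|\cdot|_F$ is the Frobenius norm. A function $a:\mathbb R_{\ge0}\to\mathbb R_{\ge0}$ is in $\mathcal K$ if it is continuous, strictly increasing and $a(0)=0$, and in $\mathcal K_\infty$ if moreover $a(r)\to\infty$ as $r\to\infty$; it is in $\mathcal K_\infty^{k\text{-SE}}$ if moreover $\ln a(r^k)=o(r)$ as $r\to\infty$. A function $\eta:\mathbb N_0\to\mathbb R_{\ge0}$ is in $\mathcal L$ if it is non-increasing and tends to $0$. Assume: 1. $f,\psi,\alpha$ are Borel measurable. 2. $\{W(t)\}$ is i.i.d. with law $\mu_w$, $\{S(t)\}$ is i.i.d. with law $\mu_s$, the two sequences are independent, and $W(t)$ is zero-mean and $\sigma_w^2$-sub-Gaussian: $\mathbb E[\exp(\lambda\zeta^\top W(t))]\le\exp(\lambda^2\sigma_w^2/2)$ for all $\lambda\in\mathbb R$ and all unit vectors $\zeta\in\mathbb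 R^n$. 3. There are $\chi_1,\chi_3,\sigma_2\in\mathcal K_\infty^{1\text{-SE}}$, $\chi_4\in\mathcal K_\infty^{2\text{-SE}}$, $\chi_2,\sigma_1\in\mathcal K_\infty$ and $c_1\ge0$ such that every deterministic trajectory $\phi(0)=\xi$, $\phi(i+1)=g(\phi(i),u(i),w(i+1))$ with $\xi\in\mathbb X$, $u(i)\in\mathbb U$, $w(i)\in\mathbb W$ satisfies, for all $t\ge1$, $$|\phi(t)|\le\chi_1(t)+\chi_2(|\xi|)+\chi_3\Big(\sum_{i=0}^{t-1}\sigma_1(|u(i)|)\Big)+\chi_4\Big(\sum_{i=1}^t\sigma_2(|w(i)|)\Big)+c_1 .$$ 4. There is $u_{\max}\ge0$ with $|\alpha(x,s,\vartheta)|\le u_{\max}$ for all $x\in\mathbb X$, $s\in\mathbb S$, $\vartheta\in\mathbb R^{d\times n}$. 5. There is $\chi_5:\mathbb R_{\ge0}\to\mathbb R_{\ge0}$, bounded on bounded sets, with $\chi_5(r)=O(r^k)$ as $r\to\infty$ for some $k\in\mathbb N$, such that $|\psi(x,u)|\le\chi_5\big(\sqrt{|x|^2+|u|^2}\big)$ for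 all $x\in\mathbb X$, $u\in\mathbb U$. 6. (Global excitation) There are $c_{\mathrm{PE}},p_{\mathrm{PE}}>0$ such that for all $\vartheta\in\mathbb R^{d\times n}$, $x\in\mathbb X$ and unit vectors $\zeta\in\mathbb R^d$, for $(S,W)\sim\mu_s\times\mu_w$, with probability at least $p_{\mathrm{PE}}$ one has $x+W\in\mathbb X$ and $|\zeta^\top\psi(x+W,\alpha(x+W,S,\vartheta))|^2\ge c_{\mathrm{PE}}$. 7. (Global stochastic Lyapunov function) There are a Borel measurable $V:\mathbb X\to\mathbb R_{\ge0}$, $\bar\vartheta>0$, $\alpha_1,\alpha_2,\alpha_3\in\mathcal K_\infty$, $\sigma_3\in\mathcal K$ and $\tilde d\ge0$ such that for all $x\in\mathbb X$ and all $\tilde\vartheta\in\mathbb R^{d\times n}$ with $|\tilde\vartheta|\le\bar\vartheta$, $$\alpha_1(|x|)\le V(x)\le\alpha_2(|x|),\qquad \mathbf E\big[V(g(x,\alpha(x,S,\tilde\vartheta+\theta_*),W))\big]-V(x)\le-\alpha_3(|x|)+\tilde d+\sigma_3(|\tilde\vartheta|),$$ where $(S,W)\sim\mu_s\times\mu_w$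 and the expectation is finite; and $\alpha_3\circ\alpha_2^{-1}$ is bounded below by a convex function in $\mathcal K_\infty$. Then for every $\delta\in(0,1)$ there is $c_2\ge0$ such that for every initial state $x_0\in\mathbb X$ there is $\eta\in\mathcal L$ with $$\mathbb P\big(|X(t)|\le\eta(t)+c_2\big)\ge1-\delta\qquad\text{for all }t\in\mathbb N_0 .$$ -/

import Mathlib

open MeasureTheory ProbabilityTheory Filter Topology
open scoped NNReal Matrix

namespace AdaptiveStabilisation

/-- Vectors in `ℝⁿ`, with the Euclidean norm. -/
abbrev Vec (n : ℕ) : Type := EuclideanSpace ℝ (Fin n)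

/-- Parameters in `ℝ^{d × n}`. -/
abbrev Param (d n : ℕ) : Type := Matrix (Fin d) (Fin n) ℝ

/-- The induced 2-norm of a matrix. -/
noncomputable def inducedNorm {d n : ℕ} (A : Param d n) : ℝ≥0 :=
  ‖(Matrix.toEuclideanLin A).toContinuousLinearMap‖₊

/-- The squared Frobenius norm of a matrix. -/
def frobeniusSq {d n : ℕ} (A : Param d n) : ℝ := ∑ i, ∑ j, A i j ^ 2

/-- The vector `ϑᵀ z` for `ϑ ∈ ℝ^{d × n}` and `z ∈ ℝᵈ`. -/
noncomputable def regress {d n : ℕ} (ϑ : Param d n) (z : Vec d) : Vec n :=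
  Matrix.toEuclideanLin ϑᵀ z

/-! ### Comparison functions -/

/-- Class `𝓚`. -/
structure ClassK (a : ℝ≥0 → ℝ≥0) : Prop where
  continuous : Continuous a
  strictMono : StrictMono a
  map_zero : a 0 = 0

/-- Class `𝓚_∞`. -/
structure ClassKInf (a : ℝ≥0 → ℝ≥0) : Prop extends ClassK a where
  unbounded : Tendsto a atTop atTop

/-- `k`-order sub-exponential functions: `ln (h (r ^ k)) = o(r)` as `r → ∞`. -/
def SubExponential (k : ℕ) (h : ℝ≥0 → ℝ≥0) : Prop :=
  (fun r : ℝ≥0 => Real.log (h (r ^ k))) =o[atTop] (fun r : ℝ≥0 => (r : ℝ))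

/-- Class `𝓚_∞` functions that are `k`-order sub-exponential. -/
def ClassKInfSE (k : ℕ) (a : ℝ≥0 → ℝ≥0) : Prop := ClassKInf a ∧ SubExponential k a

/-- Asymptotically polynomially bounded functions. -/
def AsympPolyBounded (h : ℝ≥0 → ℝ≥0) : Prop :=
  ∃ k : ℕ, (fun r : ℝ≥0 => (h r : ℝ)) =O[atTop] (fun r : ℝ≥0 => (r : ℝ) ^ k)

/-- Class `𝓛`. -/
structure ClassL (η : ℕ → ℝ≥0) : Prop where
  antitone : Antitone η
  tendsto_zero : Tendsto η atTop (𝓝 0)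

/-! ### The system and the adaptive controller -/

/-- A stochastic system `X(t+1) = f(X(t),U(t)) + θ⋆ᵀ ψ(X(t),U(t)) + W(t+1)` together with a
parameterised control policy `α`. The states, controls, process noise and exploratory noise
take values in the sets `𝕏 ⊆ ℝⁿ`, `𝕌 ⊆ ℝᵐ`, `𝕎 ⊆ ℝⁿ` and `𝕊 ⊆ ℝ^q`. The map
`g(x,u,w) = f(x,u) + θ⋆ᵀ ψ(x,u) + w` has values in `𝕏`, both for the process noise `w ∈ 𝕎`
and for `w = 0` (the one-step prediction). -/
structure System (n m d q : ℕ) where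
  /-- the state space -/
  𝕏 : Set (Vec n)
  /-- the set of controls -/
  𝕌 : Set (Vec m)
  /-- the set of process noise values -/
  𝕎 : Set (Vec n)
  /-- the set of exploratory noise values -/
  𝕊 : Set (Vec q)
  /-- the nominal system model -/
  f : 𝕏 → 𝕌 → Vec n
  /-- the basis functions -/
  ψ : 𝕏 → 𝕌 → Vec d
  /-- the true system parameter -/
  θstar : Param d n
  /-- the control policy -/
  α : 𝕏 → 𝕊 → Param d n → 𝕌
  noisy_mem : ∀ (x : 𝕏) (u : 𝕌) (w : 𝕎), f x u + regress θstar (ψ x u) + (w : Vec n) ∈ 𝕏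
  nominal_mem : ∀ (x : 𝕏) (u : 𝕌), f x u + regress θstar (ψ x u) ∈ 𝕏

namespace System

variable {n m d q : ℕ} (sys : System n m d q)

/-- The state transition map `g`. -/
noncomputable def g (x : sys.𝕏) (u : sys.𝕌) (w : sys.𝕎) : sys.𝕏 :=
  ⟨sys.f x u + regress sys.θstar (sys.ψ x u) + (w : Vec n), sys.noisy_mem x u w⟩

/-- The deterministic solution `φ(t, ξ, u, w)`. Here `w i` is the noise that enters the state
at time `i + 1`; only `u 0, …, u (t-1)` and `w 0, …, w (t-1)` matter. -/
noncomputable def φ (ξ : sys.𝕏) (u : ℕ → sys.𝕌) (w : ℕ → sys.𝕎) : ℕ → sys.𝕏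
  | 0 => ξ
  | t + 1 => sys.g (φ ξ u w t) (u t) (w t)

/-- The cost whose minimiser over `ϑ` is the regularised least squares estimate at time `t`,
along given states `x` and controls `u`, with regularisation parameter `γ`. -/
noncomputable def rlsCost (γ : ℝ) (x : ℕ → sys.𝕏) (u : ℕ → sys.𝕌) (t : ℕ)
    (ϑ : Param d n) : ℝ :=
  (∑ s ∈ Finset.range t,
    ‖(x (s + 1) : Vec n) - regress ϑ (sys.ψ (x s) (u s)) - sys.f (x s) (u s)‖ ^ 2)
    + γ * frobeniusSq ϑ

/-- The closed loop of the system with the certainty equivalence adaptive controller, started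
at `x₀`: states `X`, controls `U` and regularised least squares estimates `θhat`, with
regularisation parameter `γ` and initial estimate `θhat(-1) = θhat(0) = ϑ₀`.
`W t` is the process noise that enters the state at time `t + 1`. -/
structure IsClosedLoop {Ω : Type*} (W : ℕ → Ω → sys.𝕎) (S : ℕ → Ω → sys.𝕊)
    (γ : ℝ) (ϑ₀ : Param d n) (x₀ : sys.𝕏)
    (X : ℕ → Ω → sys.𝕏) (U : ℕ → Ω → sys.𝕌) (θhat : ℕ → Ω → Param d n) : Prop where
  state_zero : ∀ ω, X 0 ω = x₀
  state_succ : ∀ t ω, X (t + 1) ω = sys.g (X t ω) (U t ω) (W t ω)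
  control_zero : ∀ ω, U 0 ω = sys.α (X 0 ω) (S 0 ω) ϑ₀
  control_succ : ∀ t ω, U (t + 1) ω = sys.α (X (t + 1) ω) (S (t + 1) ω) (θhat t ω)
  estimate_zero : ∀ ω, θhat 0 ω = ϑ₀
  estimate_argmin : ∀ t, 1 ≤ t → ∀ ω,
    IsMinOn (sys.rlsCost γ (fun s => X s ω) (fun s => U s ω) t) Set.univ (θhat t ω)

/-! ### Standing assumptions -/

/-- The system mappings are Borel measurable (for the subspace Borel structures). -/
structure BorelMappings : Prop where
  f : Measurable fun p : sys.𝕏 × sys.𝕌 => sys.f p.1 p.2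
  ψ : Measurable fun p : sys.𝕏 × sys.𝕌 => sys.ψ p.1 p.2
  α : Measurable fun p : sys.𝕏 × sys.𝕊 × (Fin d → Fin n → ℝ) =>
    sys.α p.1 p.2.1 (Matrix.of p.2.2)

/-- The process noise is i.i.d. with law `μw`, zero mean and `σw²`-sub-Gaussian, the exploratory
noise is i.i.d. with law `μs`, and the two sequences are independent. -/
structure NoiseAssumption {Ω : Type*} [MeasurableSpace Ω] (P : Measure Ω)
    (W : ℕ → Ω → sys.𝕎) (S : ℕ → Ω → sys.𝕊)
    (μw : Measure sys.𝕎) (μs : Measure sys.𝕊) (σw : ℝ≥0) : Prop where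
  measurable_W : ∀ t, Measurable (W t)
  measurable_S : ∀ t, Measurable (S t)
  law_W : ∀ t, P.map (W t) = μw
  law_S : ∀ t, P.map (S t) = μs
  iIndep_W : iIndepFun W P
  iIndep_S : iIndepFun S P
  indep_W_S : IndepFun (fun ω t => W t ω) (fun ω t => S t ω) P
  mean_zero : ∀ t, ∫ ω, (W t ω : Vec n) ∂P = 0
  subGaussian : ∀ t, ∀ ζ : Vec n, ‖ζ‖ = 1 →
    HasSubgaussianMGF (fun ω => inner ℝ ζ (W t ω : Vec n)) (σw ^ 2) P

/-- Sub-exponential input-to-state bound on the reachable states. -/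
def SubExpReachable : Prop :=
  ∃ χ₁ χ₂ χ₃ χ₄ σ₁ σ₂ : ℝ≥0 → ℝ≥0, ∃ c₁ : ℝ≥0,
    ClassKInfSE 1 χ₁ ∧ ClassKInfSE 1 χ₃ ∧ ClassKInfSE 1 σ₂ ∧ ClassKInfSE 2 χ₄ ∧
    ClassKInf χ₂ ∧ ClassKInf σ₁ ∧
    ∀ t : ℕ, 1 ≤ t → ∀ (ξ : sys.𝕏) (u : ℕ → sys.𝕌) (w : ℕ → sys.𝕎),
      ‖(sys.φ ξ u w t : Vec n)‖₊ ≤ χ₁ t + χ₂ ‖(ξ : Vec n)‖₊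
        + χ₃ (∑ i ∈ Finset.range t, σ₁ ‖(u i : Vec m)‖₊)
        + χ₄ (∑ i ∈ Finset.range t, σ₂ ‖(w i : Vec n)‖₊) + c₁

/-- The policy generates controls of bounded magnitude. -/
def ConstrainedControls : Prop :=
  ∃ umax : ℝ≥0, ∀ (x : sys.𝕏) (s : sys.𝕊) (ϑ : Param d n), ‖(sys.α x s ϑ : Vec m)‖₊ ≤ umax

/-- The basis functions are bounded by an asymptotically polynomially bounded function of
the magnitude of the stacked vector of the state and the control; the bounding function is
bounded on bounded sets. -/
def PolyBasis : Prop :=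
  ∃ χ₅ : ℝ≥0 → ℝ≥0, AsympPolyBounded χ₅ ∧ (∀ R : ℝ≥0, BddAbove (χ₅ '' Set.Iic R)) ∧
    ∀ (x : sys.𝕏) (u : sys.𝕌),
      ‖sys.ψ x u‖₊ ≤ χ₅ (NNReal.sqrt (‖(x : Vec n)‖₊ ^ 2 + ‖(u : Vec m)‖₊ ^ 2))

/-! ### Excitation -/

/-- `(𝒳, c, p)`-regional excitation. Since `ψ` and `α` only live on `𝕏`, the event includes
that `x + w` is a state. -/
def RegionallyExcited (μw : Measure sys.𝕎) (μs : Measure sys.𝕊) (𝒳 : Set sys.𝕏) (c p : ℝ) :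
    Prop :=
  ∀ (ϑ : Param d n), ∀ x ∈ 𝒳, ∀ ζ : Vec d, ‖ζ‖ = 1 →
    p ≤ (μs.prod μw).real {sw : sys.𝕊 × sys.𝕎 | ∃ h : (x : Vec n) + (sw.2 : Vec n) ∈ sys.𝕏,
      c ≤ |inner ℝ ζ (sys.ψ ⟨_, h⟩ (sys.α ⟨_, h⟩ sw.1 ϑ))| ^ 2}

/-- `(c, p)`-global excitation: regional excitation over the whole state space. -/
def GloballyExcited (μw : Measure sys.𝕎) (μs : Measure sys.𝕊) (c p : ℝ) : Prop :=
  sys.RegionallyExcited μw μs Set.univ c p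

/-! ### Stochastic Lyapunov functions -/

/-- `𝒳` is a robustly positive invariant set with error constant `ϑbar`. -/
def RobustlyInvariant (𝒳 : Set sys.𝕏) (ϑbar : ℝ≥0) : Prop :=
  ∀ x ∈ 𝒳, ∀ (w : sys.𝕎) (s : sys.𝕊) (ϑ : Param d n), inducedNorm (ϑ - sys.θstar) ≤ ϑbar →
    sys.g x (sys.α x s ϑ) w ∈ 𝒳

/-- The value of `V` after one closed-loop step from `x` with estimation error `ϑerr`, as a
function of the exploratory and the process noise. -/
noncomputable def nextV (V : sys.𝕏 → ℝ≥0) (x : sys.𝕏) (ϑerr : Param d n)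
    (sw : sys.𝕊 × sys.𝕎) : ℝ :=
  V (sys.g x (sys.α x sw.1 (ϑerr + sys.θstar)) sw.2)

/-- The expected increase `ΔV(x, ϑerr)`. -/
noncomputable def lyapunovDiff (μw : Measure sys.𝕎) (μs : Measure sys.𝕊)
    (V : sys.𝕏 → ℝ≥0) (x : sys.𝕏) (ϑerr : Param d n) : ℝ :=
  ∫ sw, sys.nextV V x ϑerr sw ∂(μs.prod μw) - V x

/-- `V` is a stochastic Lyapunov function over `𝒳` with the estimation error bound `ϑbar`
(only the values of `V` on `𝒳` matter). The dissipation inequality includes that the expectation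
in `ΔV` is finite. -/
def StochasticLyapunov (μw : Measure sys.𝕎) (μs : Measure sys.𝕊)
    (V : sys.𝕏 → ℝ≥0) (𝒳 : Set sys.𝕏) (ϑbar : ℝ≥0) : Prop :=
  Measurable (fun x : 𝒳 => V x) ∧ sys.RobustlyInvariant 𝒳 ϑbar ∧
  ∃ α₁ α₂ α₃ σ₃ : ℝ≥0 → ℝ≥0, ∃ dtil : ℝ≥0,
    ClassKInf α₁ ∧ ClassKInf α₂ ∧ ClassKInf α₃ ∧ ClassK σ₃ ∧
    (∀ x ∈ 𝒳, α₁ ‖(x : Vec n)‖₊ ≤ V x ∧ V x ≤ α₂ ‖(x : Vec n)‖₊) ∧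
    (∀ x ∈ 𝒳, ∀ ϑerr : Param d n, inducedNorm ϑerr ≤ ϑbar →
      Integrable (sys.nextV V x ϑerr) (μs.prod μw) ∧
      sys.lyapunovDiff μw μs V x ϑerr
        ≤ -(α₃ ‖(x : Vec n)‖₊ : ℝ) + dtil + σ₃ (inducedNorm ϑerr)) ∧
    ∃ αv : ℝ≥0 → ℝ≥0, ClassKInf αv ∧ ConvexOn ℝ≥0 Set.univ αv ∧
      ∀ r, αv r ≤ α₃ (Function.invFun α₂ r)

/-- `V` is a global stochastic Lyapunov function with the estimation error bound `ϑbar`. -/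
def GlobalStochasticLyapunov (μw : Measure sys.𝕎) (μs : Measure sys.𝕊)
    (V : sys.𝕏 → ℝ≥0) (ϑbar : ℝ≥0) : Prop :=
  sys.StochasticLyapunov μw μs V Set.univ ϑbar

end System

end AdaptiveStabilisation

/-! Two facts combine: the estimate almost surely enters the region where the Lyapunov inequality
applies, and from then on the Lyapunov value forgets its starting point geometrically.

Consistency. Comparing the least squares cost at the estimate with its value at the true parameter
shows that the energy of the prediction error is at most twice its correlation with the noise, plus
a constant (`sum_sq_regress_le`). In a fixed direction, excitation makes this energy grow linearly
except on an exponentially unlikely event, while the sub-Gaussian correlation cannot keep up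
(`exists_deviation_bound`). Both estimates are Chernoff bounds obtained by integrating out fresh
noise one step at a time. To treat the random direction of the error, it is shrunk into a cube and
rounded to a grid of mesh about `exp (-κ t)`. Such a grid has few enough points for a union bound,
and the rounding error stays bounded because states and regressors grow almost surely slower than
any exponential. This is where the sub-exponential reachability bound enters. Borel–Cantelli gives
`ae_eventually_inducedNorm_le`.

Stability. Convexity of the lower bound on `α₃ ∘ α₂⁻¹` turns dissipation into a drift `ρ V + D` with
`ρ < 1` (`exists_drift`). Up to a small probability there are a deterministic time `T` after which
the estimate is always good and a bound `M` on `V` at time `T + 1`. Iterating the drift on the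
adapted event that nothing has gone wrong yet gives `ρ ^ k * M + D / (1 - ρ)`. Only the first term
depends on the initial state and it vanishes, so Markov's inequality yields a uniform `c₂`
(`exists_eventual_bound`). The finitely many earlier times are absorbed in `η`. -/

namespace AdaptiveStabilisation

/-! ### Generic probability -/

section Probability

variable {Ω : Type*} {mΩ : MeasurableSpace Ω} {P : Measure Ω} [IsProbabilityMeasure P]

/-- Freezing the past: since `(Y, A)` is independent of `Z`, Tonelli on the product law integrates
`Z` out first. The arbitrary weight `Y` does the work of conditional expectation. -/
theorem lintegral_mul_of_indep {m mΩ : MeasurableSpace Ω} {P : Measure Ω} [IsProbabilityMeasure P]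
    (hm : m ≤ mΩ) {α β : Type*}
    [MeasurableSpace α] [mβ : MeasurableSpace β] {Y : Ω → ENNReal} (hY : Measurable[m] Y)
    {A : Ω → α} (hA : Measurable[m] A) {Z : Ω → β} (hZ : Measurable Z)
    (hind : Indep m (mβ.comap Z) P) {F : α × β → ENNReal} (hF : Measurable F) :
    ∫⁻ ω, Y ω * F (A ω, Z ω) ∂P = ∫⁻ ω, Y ω * ∫⁻ z, F (A ω, z) ∂(P.map Z) ∂P := by
  have hB : Measurable[m] fun ω => (Y ω, A ω) := hY.prodMk hA
  have hB' : Measurable fun ω => (Y ω, A ω) := hB.mono hm le_rfl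
  have hI : IndepFun (fun ω => (Y ω, A ω)) Z P := by
    rw [IndepFun_iff_Indep]
    exact indep_of_indep_of_le_left hind hB.comap_le
  have hmap := (indepFun_iff_map_prod_eq_prod_map_map hB'.aemeasurable hZ.aemeasurable).1 hI
  have : IsProbabilityMeasure (P.map Z) := Measure.isProbabilityMeasure_map hZ.aemeasurable
  have hH : Measurable fun x : (ENNReal × α) × β => x.1.1 * F (x.1.2, x.2) := by fun_prop
  have h1 : ∫⁻ ω, Y ω * F (A ω, Z ω) ∂P
      = ∫⁻ x, x.1.1 * F (x.1.2, x.2) ∂(P.map fun ω => ((Y ω, A ω), Z ω)) := by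
    rw [lintegral_map hH (hB'.prodMk hZ)]
  rw [h1, hmap, lintegral_prod _ hH.aemeasurable, lintegral_map _ hB']
  · refine lintegral_congr fun ω => ?_
    exact lintegral_const_mul _ (hF.comp measurable_prodMk_left)
  · exact hH.lintegral_prod_right'

/-- The supermartingale argument: `hstep`, quantified over all weights from the past, says that the
conditional exponential moment is at most `ρ`. Take as weight the exponential of the partial sum. -/
theorem lintegral_exp_sum_le {ℱ : ℕ → MeasurableSpace Ω} (hmono : Monotone ℱ)
    {R : ℕ → Ω → ℝ} (hR : ∀ s, Measurable[ℱ (s + 1)] (R s)) {ρ : ENNReal}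
    (hstep : ∀ s (Y : Ω → ENNReal), Measurable[ℱ s] Y →
      ∫⁻ ω, Y ω * ENNReal.ofReal (Real.exp (R s ω)) ∂P ≤ ρ * ∫⁻ ω, Y ω ∂P) (t : ℕ) :
    ∫⁻ ω, ENNReal.ofReal (Real.exp (∑ s ∈ Finset.range t, R s ω)) ∂P ≤ ρ ^ t := by
  have hm : ∀ t, Measurable[ℱ t]
      fun ω => ENNReal.ofReal (Real.exp (∑ s ∈ Finset.range t, R s ω)) := by
    intro t
    refine ENNReal.measurable_ofReal.comp (Real.measurable_exp.comp ?_)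
    refine Finset.measurable_sum _ fun s hs => ?_
    exact (hR s).mono (hmono (Finset.mem_range.1 hs)) le_rfl
  induction t with
  | zero => simp
  | succ t ih =>
    have h1 := hstep t _ (hm t)
    calc _ = ∫⁻ ω, ENNReal.ofReal (Real.exp (∑ s ∈ Finset.range t, R s ω))
          * ENNReal.ofReal (Real.exp (R t ω)) ∂P := by
            refine lintegral_congr fun ω => ?_
            rw [Finset.sum_range_succ, Real.exp_add, ENNReal.ofReal_mul (Real.exp_nonneg _)]
      _ ≤ _ := h1
      _ ≤ ρ * ρ ^ t := by gcongr
      _ = _ := (pow_succ' ρ t).symm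

omit [IsProbabilityMeasure P] in
theorem measure_exp_ge_le {f : Ω → ℝ} (hf : Measurable f) {c : ENNReal}
    (h : ∫⁻ ω, ENNReal.ofReal (Real.exp (f ω)) ∂P ≤ c) (a : ℝ) :
    P {ω | a ≤ f ω} ≤ c * ENNReal.ofReal (Real.exp (-a)) := by
  have h1 := mul_meas_ge_le_lintegral (μ := P)
    (hf.exp.ennreal_ofReal) (ENNReal.ofReal (Real.exp a))
  have h2 : {ω | a ≤ f ω} = {ω | ENNReal.ofReal (Real.exp a) ≤ ENNReal.ofReal (Real.exp (f ω))} := by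
    ext ω
    simp [ENNReal.ofReal_le_ofReal_iff (Real.exp_nonneg _)]
  have h3 : ENNReal.ofReal (Real.exp (-a)) * ENNReal.ofReal (Real.exp a) = 1 := by
    rw [← ENNReal.ofReal_mul (Real.exp_nonneg _), ← Real.exp_add]; simp
  calc P {ω | a ≤ f ω} = ENNReal.ofReal (Real.exp (-a)) * (ENNReal.ofReal (Real.exp a)
        * P {ω | a ≤ f ω}) := by rw [← mul_assoc, h3, one_mul]
    _ ≤ ENNReal.ofReal (Real.exp (-a)) * c := by
        rw [h2]; gcongr; exact h1.trans h
    _ = _ := mul_comm _ _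

theorem exists_measure_gt_le {f : Ω → ℝ≥0} (hf : Measurable f) {ε : ENNReal} (hε : ε ≠ 0) :
    ∃ M : ℝ≥0, P {ω | M < f ω} ≤ ε := by
  have h := tendsto_measure_iInter_atTop (μ := P) (s := fun k : ℕ => {ω | (k : ℝ≥0) < f ω})
    (fun k => (measurableSet_lt measurable_const hf).nullMeasurableSet)
    (fun i j hij ω (hω : (j : ℝ≥0) < f ω) =>
      show (i : ℝ≥0) < f ω from lt_of_le_of_lt (by exact_mod_cast hij) hω)
    ⟨0, measure_ne_top _ _⟩
  have h0 : (⋂ k : ℕ, {ω | (k : ℝ≥0) < f ω}) = ∅ := by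
    ext ω
    simp only [Set.mem_iInter, Set.mem_ofPred_eq, Set.mem_empty_iff_false, iff_false, not_forall,
      not_lt]
    exact exists_nat_ge (f ω)
  rw [h0, measure_empty] at h
  obtain ⟨k, hk⟩ := (h.eventually (ge_mem_nhds (pos_iff_ne_zero.2 hε))).exists
  exact ⟨k, hk⟩

/-- The failure events decrease in `T` to a null set, so continuity from above turns a random entry
time into a deterministic one. -/
theorem exists_measure_not_forall_ge_le {p : ℕ → Ω → Prop}
    (hp : ∀ t, MeasurableSet {ω | p t ω}) (h : ∀ᵐ ω ∂P, ∀ᶠ t in atTop, p t ω)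
    {ε : ENNReal} (hε : ε ≠ 0) : ∃ T : ℕ, P {ω | ¬ ∀ t, T ≤ t → p t ω} ≤ ε := by
  have hm : ∀ T : ℕ, MeasurableSet {ω | ¬ ∀ t, T ≤ t → p t ω} := by
    intro T
    have : {ω | ¬ ∀ t, T ≤ t → p t ω} = (⋂ t, ⋂ (_ : T ≤ t), {ω | p t ω})ᶜ := by ext; simp
    rw [this]
    exact (MeasurableSet.iInter fun t => MeasurableSet.iInter fun _ => hp t).compl
  have ht := tendsto_measure_iInter_atTop (μ := P)
    (s := fun T : ℕ => {ω | ¬ ∀ t, T ≤ t → p t ω})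
    (fun k => (hm k).nullMeasurableSet)
    (fun i j hij ω hω hi => hω fun t ht => hi t (hij.trans ht))
    ⟨0, measure_ne_top _ _⟩
  have h0 : P (⋂ T : ℕ, {ω | ¬ ∀ t, T ≤ t → p t ω}) = 0 := by
    refine measure_mono_null ?_ (ae_iff.1 h)
    intro ω hω
    simp only [Set.mem_iInter, Set.mem_ofPred_eq] at hω ⊢
    intro hev
    obtain ⟨T, hT⟩ := eventually_atTop.1 hev
    exact hω T hT
  rw [h0] at ht
  obtain ⟨k, hk⟩ := (ht.eventually (ge_mem_nhds (pos_iff_ne_zero.2 hε))).exists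
  exact ⟨k, hk⟩

omit [IsProbabilityMeasure P] in
-- The series `∑ Y i ^ 2 / (i + 1) ^ 2` has finite mean, hence is almost surely finite, and it
-- dominates each of its terms.
theorem ae_exists_linear_bound {Y : ℕ → Ω → ℝ≥0} (hY : ∀ i, Measurable (Y i)) {C : ENNReal}
    (hC : C ≠ ⊤) (h : ∀ i, ∫⁻ ω, (Y i ω : ENNReal) ^ 2 ∂P ≤ C) :
    ∀ᵐ ω ∂P, ∃ K : ℕ, ∀ i, Y i ω ≤ K * (i + 1) := by
  set a : ℕ → ℝ≥0 := fun i => (((i : ℝ≥0) + 1) ^ 2)⁻¹ with ha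
  have hsum : Summable a := by
    rw [← NNReal.summable_coe]
    have h2 : Summable fun i : ℕ => (((i : ℝ)) ^ 2)⁻¹ :=
      Real.summable_nat_pow_inv.2 one_lt_two
    refine ((summable_nat_add_iff 1).2 h2).congr fun i => ?_
    simp [ha]
  have hfin : ∫⁻ ω, ∑' i, (a i : ENNReal) * (Y i ω : ENNReal) ^ 2 ∂P ≠ ⊤ := by
    rw [lintegral_tsum fun i => (by have := hY i; fun_prop)]
    refine ne_top_of_le_ne_top (b := ∑' i, (a i : ENNReal) * C) ?_ ?_
    · rw [ENNReal.tsum_mul_right]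
      exact ENNReal.mul_ne_top (ENNReal.tsum_coe_ne_top_iff_summable.2 hsum) hC
    · refine ENNReal.tsum_le_tsum fun i => ?_
      rw [lintegral_const_mul _ (by have := hY i; fun_prop)]
      gcongr
      exact h i
  have hae := ae_lt_top (by
    refine Measurable.tsum fun i => ?_
    have := hY i; fun_prop) hfin
  filter_upwards [hae] with ω hω
  set K := (∑' i, (a i : ENNReal) * (Y i ω : ENNReal) ^ 2).toNNReal with hK
  obtain ⟨N, hN⟩ := exists_nat_ge (K + 1)
  refine ⟨N, fun i => ?_⟩
  have h1 : (a i : ENNReal) * (Y i ω : ENNReal) ^ 2 ≤ K := by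
    rw [hK, ENNReal.coe_toNNReal hω.ne]
    exact ENNReal.le_tsum i
  have h2 : a i * Y i ω ^ 2 ≤ K := by exact_mod_cast h1
  have hpos : (0 : ℝ≥0) < ((i : ℝ≥0) + 1) ^ 2 := by positivity
  have h3 : Y i ω ^ 2 ≤ K * ((i : ℝ≥0) + 1) ^ 2 := by
    rw [ha] at h2
    simp only at h2
    rwa [inv_mul_le_iff₀ hpos, mul_comm] at h2
  have h4 : K ≤ (N : ℝ≥0) ^ 2 := by
    have : (1 : ℝ≥0) ≤ N := le_trans (by simp) hN
    calc K ≤ K + 1 := by simp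
      _ ≤ N := hN
      _ ≤ N ^ 2 := by nlinarith
  have h5 : Y i ω ^ 2 ≤ (N * ((i : ℝ≥0) + 1)) ^ 2 := by
    rw [mul_pow]; exact h3.trans (by gcongr)
  exact (pow_le_pow_iff_left₀ (zero_le) (zero_le) two_ne_zero).1 h5

end Probability

/-! ### The filtration of the noise -/

section Noise

variable {Ω α β : Type*} {mΩ : MeasurableSpace Ω} [mα : MeasurableSpace α] [mβ : MeasurableSpace β]
  {P : Measure Ω}

/-- The σ-algebras generated by the single noise variables. -/
@[reducible] def noiseSigma (W : ℕ → Ω → α) (S : ℕ → Ω → β) : ℕ ⊕ ℕ → MeasurableSpace Ω :=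
  Sum.elim (fun i => mα.comap (W i)) (fun j => mβ.comap (S j))

/-- The indices `W i`, `i < a`, and `S j`, `j < b`. -/
def pastIndex (a b : ℕ) : Set (ℕ ⊕ ℕ) := {k | Sum.elim (fun i => i < a) (fun j => j < b) k}

/-- The σ-algebra generated by `W i`, `i < a`, and `S j`, `j < b`. -/
@[reducible] def past (W : ℕ → Ω → α) (S : ℕ → Ω → β) (a b : ℕ) : MeasurableSpace Ω :=
  ⨆ k ∈ pastIndex a b, noiseSigma W S k

variable {W : ℕ → Ω → α} {S : ℕ → Ω → β}

theorem noiseSigma_le (hW : ∀ t, Measurable (W t)) (hS : ∀ t, Measurable (S t)) (k : ℕ ⊕ ℕ) :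
    noiseSigma W S k ≤ mΩ := by
  cases k with
  | inl i => exact (hW i).comap_le
  | inr j => exact (hS j).comap_le

theorem past_le (hW : ∀ t, Measurable (W t)) (hS : ∀ t, Measurable (S t)) (a b : ℕ) :
    past W S a b ≤ mΩ :=
  iSup₂_le fun k _ => noiseSigma_le hW hS k

omit mΩ in
theorem past_mono {a a' b b' : ℕ} (ha : a ≤ a') (hb : b ≤ b') :
    past W S a b ≤ past W S a' b' := by
  refine biSup_mono fun k hk => ?_
  cases k with
  | inl i => exact lt_of_lt_of_le hk ha
  | inr j => exact lt_of_lt_of_le hk hb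

omit mΩ in
theorem measurable_past_left {i a b : ℕ} (h : i < a) : Measurable[past W S a b] (W i) := by
  rw [measurable_iff_comap_le]
  exact le_iSup₂_of_le (f := fun k (_ : k ∈ pastIndex a b) => noiseSigma W S k) (Sum.inl i) h le_rfl

omit mΩ in
theorem measurable_past_right {j a b : ℕ} (h : j < b) : Measurable[past W S a b] (S j) := by
  rw [measurable_iff_comap_le]
  exact le_iSup₂_of_le (f := fun k (_ : k ∈ pastIndex a b) => noiseSigma W S k) (Sum.inr j) h le_rfl

/-- A finite intersection splits into a `W`-cylinder and an `S`-cylinder. Independence of the two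
sequences separates these, and independence within each sequence factors them further. -/
theorem iIndep_noiseSigma (hW : iIndepFun W P) (hS : iIndepFun S P)
    (hWS : IndepFun (fun ω t => W t ω) (fun ω t => S t ω) P) : iIndep (noiseSigma W S) P := by
  rw [iIndep_iff]
  intro s f hf
  have h1 : (⋂ k ∈ s, f k) = (⋂ i ∈ s.toLeft, f (Sum.inl i)) ∩ ⋂ j ∈ s.toRight, f (Sum.inr j) := by
    ext ω
    simp
  have hl : ∀ i ∈ s.toLeft, MeasurableSet[mα.comap (W i)] (f (Sum.inl i)) := fun i hi =>
    hf (Sum.inl i) (Finset.mem_toLeft.1 hi)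
  have hr : ∀ j ∈ s.toRight, MeasurableSet[mβ.comap (S j)] (f (Sum.inr j)) := fun j hj =>
    hf (Sum.inr j) (Finset.mem_toRight.1 hj)
  have h2 : MeasurableSet[(MeasurableSpace.pi).comap (fun ω t => W t ω)]
      (⋂ i ∈ s.toLeft, f (Sum.inl i)) := by
    refine Finset.measurableSet_biInter _ fun i hi => ?_
    obtain ⟨A, hA, hAf⟩ := hl i hi
    exact ⟨(fun x => x i) ⁻¹' A, measurable_pi_apply i hA, hAf⟩
  have h3 : MeasurableSet[(MeasurableSpace.pi).comap (fun ω t => S t ω)]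
      (⋂ j ∈ s.toRight, f (Sum.inr j)) := by
    refine Finset.measurableSet_biInter _ fun j hj => ?_
    obtain ⟨A, hA, hAf⟩ := hr j hj
    exact ⟨(fun x => x j) ⁻¹' A, measurable_pi_apply j hA, hAf⟩
  rw [h1, (Indep_iff _ _ _).1 ((IndepFun_iff_Indep _ _ _).1 hWS) _ _ h2 h3,
    (iIndepFun_iff _ _ _).1 hW _ hl, (iIndepFun_iff _ _ _).1 hS _ hr,
    ← Finset.prod_disjSum s.toLeft s.toRight fun k => P (f k), Finset.toLeft_disjSum_toRight]

variable (hWm : ∀ t, Measurable (W t)) (hSm : ∀ t, Measurable (S t))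
  (hind : iIndep (noiseSigma W S) P)

include hWm hSm hind

theorem indep_past_left {a b i : ℕ} (hi : a ≤ i) : Indep (past W S a b) (mα.comap (W i)) P := by
  have h := indep_iSup_of_disjoint (noiseSigma_le hWm hSm) hind
    (S := pastIndex a b) (T := {Sum.inl i})
    (by rw [Set.disjoint_singleton_right]; exact fun h => absurd hi (not_le.2 h))
  rw [iSup_singleton] at h
  exact h

theorem indep_past_pair {a b i j : ℕ} (hi : a ≤ i) (hj : b ≤ j) :
    Indep (past W S a b) (MeasurableSpace.comap (fun ω => (S j ω, W i ω)) inferInstance) P := by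
  have h := indep_iSup_of_disjoint (noiseSigma_le hWm hSm) hind
    (S := pastIndex a b) (T := {Sum.inl i, Sum.inr j})
    (by
      rw [Set.disjoint_right]
      rintro k (rfl | rfl)
      · exact fun h => absurd hi (not_le.2 h)
      · exact fun h => absurd hj (not_le.2 h))
  refine indep_of_indep_of_le_right h ?_
  rw [← measurable_iff_comap_le]
  refine Measurable.prodMk ?_ ?_
  · rw [measurable_iff_comap_le]
    exact le_iSup₂_of_le (f := fun k (_ : k ∈ ({Sum.inl i, Sum.inr j} : Set (ℕ ⊕ ℕ))) =>
      noiseSigma W S k) (Sum.inr j) (by simp) le_rfl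
  · rw [measurable_iff_comap_le]
    exact le_iSup₂_of_le (f := fun k (_ : k ∈ ({Sum.inl i, Sum.inr j} : Set (ℕ ⊕ ℕ))) =>
      noiseSigma W S k) (Sum.inl i) (by simp) le_rfl

theorem map_pair [IsFiniteMeasure P] (i j : ℕ) :
    P.map (fun ω => (S j ω, W i ω)) = (P.map (S j)).prod (P.map (W i)) := by
  refine (indepFun_iff_map_prod_eq_prod_map_map (hSm j).aemeasurable (hWm i).aemeasurable).1 ?_
  rw [IndepFun_iff_Indep]
  have := hind.indep (i := Sum.inr j) (j := Sum.inl i) (by simp)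
  exact this

end Noise

/-! ### Regularised least squares -/

section LeastSquares

variable {d n : ℕ}

theorem regress_apply (ϑ : Param d n) (z : Vec d) (j : Fin n) :
    regress ϑ z j = ∑ i, ϑ i j * z i := by
  simp [regress, Matrix.toLpLin_apply, Matrix.mulVec, dotProduct]

theorem regress_add (ϑ D : Param d n) (z : Vec d) :
    regress (ϑ + D) z = regress ϑ z + regress D z := by
  ext j; simp [regress_apply, add_mul, Finset.sum_add_distrib]

theorem regress_smul (c : ℝ) (ϑ : Param d n) (z : Vec d) :
    regress (c • ϑ) z = c • regress ϑ z := by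
  ext j; simp [regress_apply, Finset.mul_sum, mul_assoc]

theorem regress_sub (ϑ D : Param d n) (z : Vec d) :
    regress (ϑ - D) z = regress ϑ z - regress D z := by
  ext j; simp [regress_apply, sub_mul, Finset.sum_sub_distrib]

theorem inner_regress (a : Vec n) (D : Param d n) (z : Vec d) :
    inner ℝ a (regress D z) = ∑ i, ∑ j, D i j * (z i * a j) := by
  rw [Finset.sum_comm]
  simp only [PiLp.inner_apply, regress_apply, RCLike.inner_apply, conj_trivial, Finset.sum_mul]
  refine Finset.sum_congr rfl fun j _ => Finset.sum_congr rfl fun i _ => ?_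
  ring

/-- The regularised Gram matrix of the regressors. -/
def rlsGram (γ : ℝ) (z : ℕ → Vec d) (t : ℕ) : Matrix (Fin d) (Fin d) ℝ :=
  γ • 1 + ∑ s ∈ Finset.range t, Matrix.vecMulVec (z s) (z s)

/-- The cross moments of the regressors and the targets. -/
def rlsCross (z : ℕ → Vec d) (y : ℕ → Vec n) (t : ℕ) : Param d n :=
  ∑ s ∈ Finset.range t, Matrix.vecMulVec (z s) (y s)

theorem isUnit_rlsGram {γ : ℝ} (hγ : 0 < γ) (z : ℕ → Vec d) (t : ℕ) :
    IsUnit (rlsGram γ z t) := by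
  refine Matrix.PosDef.isUnit (Matrix.PosDef.add_posSemidef ?_ ?_)
  · exact Matrix.PosDef.one.smul hγ
  · refine Matrix.posSemidef_sum _ fun s _ => ?_
    simpa using Matrix.posSemidef_vecMulVec_self_star (z s).ofLp

theorem frobeniusSq_nonneg (A : Param d n) : 0 ≤ frobeniusSq A :=
  Finset.sum_nonneg fun _ _ => Finset.sum_nonneg fun _ _ => sq_nonneg _

/-- Exact second-order expansion of the cost; its linear part is the residual of the normal
equations. -/
theorem rlsCost_add (γ : ℝ) (z : ℕ → Vec d) (y : ℕ → Vec n) (t : ℕ) (ϑ D : Param d n) :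
    (∑ s ∈ Finset.range t, ‖y s - regress (ϑ + D) (z s)‖ ^ 2) + γ * frobeniusSq (ϑ + D)
      = (∑ s ∈ Finset.range t, ‖y s - regress ϑ (z s)‖ ^ 2) + γ * frobeniusSq ϑ
        + 2 * (∑ i, ∑ j, D i j * (rlsGram γ z t * ϑ - rlsCross z y t) i j)
        + ((∑ s ∈ Finset.range t, ‖regress D (z s)‖ ^ 2) + γ * frobeniusSq D) := by
  have h1 : ∀ s, ‖y s - regress (ϑ + D) (z s)‖ ^ 2 = ‖y s - regress ϑ (z s)‖ ^ 2
      + 2 * (∑ i, ∑ j, D i j * (z s i * (regress ϑ (z s) j - y s j)))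
      + ‖regress D (z s)‖ ^ 2 := by
    intro s
    have h := inner_regress (regress ϑ (z s) - y s) D (z s)
    simp only [PiLp.sub_apply] at h
    rw [← h, regress_add, ← sub_sub, norm_sub_sq_real, ← neg_sub (y s), inner_neg_left]
    ring
  have h2 : frobeniusSq (ϑ + D) = frobeniusSq ϑ + 2 * (∑ i, ∑ j, D i j * ϑ i j)
      + frobeniusSq D := by
    simp only [frobeniusSq, Finset.mul_sum, ← Finset.sum_add_distrib, Matrix.add_apply]
    exact Finset.sum_congr rfl fun i _ => Finset.sum_congr rfl fun j _ => by ring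
  have h3 : ∀ i j, (rlsGram γ z t * ϑ - rlsCross z y t) i j
      = γ * ϑ i j + ∑ s ∈ Finset.range t, z s i * (regress ϑ (z s) j - y s j) := by
    intro i j
    have h4 : ∀ s, (Matrix.vecMulVec (z s) (z s) * ϑ) i j = z s i * regress ϑ (z s) j := by
      intro s
      rw [Matrix.vecMulVec_mul, Matrix.vecMulVec_apply, regress_apply]
      simp [Matrix.vecMul, dotProduct, mul_comm]
    simp only [rlsGram, rlsCross, Matrix.add_mul, Matrix.sub_apply, Matrix.add_apply, Matrix.sum_mul,
      Matrix.sum_apply, h4, Matrix.vecMulVec_apply, mul_sub, Finset.sum_sub_distrib,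
      Matrix.smul_mul, Matrix.one_mul, Matrix.smul_apply, smul_eq_mul]
    ring
  simp only [h1, h2, h3, mul_add, Finset.sum_add_distrib, Finset.mul_sum]
  have h5 : ∑ s ∈ Finset.range t, ∑ i, ∑ j,
      2 * (D i j * (z s i * (regress ϑ (z s) j - y s j)))
      = ∑ i, ∑ j, ∑ s ∈ Finset.range t, 2 * (D i j * (z s i * (regress ϑ (z s) j - y s j))) := by
    rw [Finset.sum_comm]
    refine Finset.sum_congr rfl fun i _ => ?_
    rw [Finset.sum_comm]
  have h6 : ∑ i, ∑ j, γ * (2 * (D i j * ϑ i j)) = ∑ i, ∑ j, 2 * (D i j * (γ * ϑ i j)) :=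
    Finset.sum_congr rfl fun i _ => Finset.sum_congr rfl fun j _ => by ring
  rw [h5, h6]
  ring

/-- Minimality forces the normal equations, and regularisation makes them uniquely solvable. The
closed formula supplies measurability of the estimate and uniqueness of the closed loop. -/
theorem eq_rls_of_isMinOn {γ : ℝ} (hγ : 0 < γ) (z : ℕ → Vec d) (y : ℕ → Vec n) (t : ℕ)
    {ϑ : Param d n} (h : IsMinOn (fun ϑ : Param d n =>
      (∑ s ∈ Finset.range t, ‖y s - regress ϑ (z s)‖ ^ 2) + γ * frobeniusSq ϑ) Set.univ ϑ) :
    ϑ = (rlsGram γ z t)⁻¹ * rlsCross z y t := by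
  set M := rlsGram γ z t * ϑ - rlsCross z y t with hM
  set q := (∑ s ∈ Finset.range t, ‖regress M (z s)‖ ^ 2) + γ * frobeniusSq M with hq
  have hq0 : 0 ≤ q := add_nonneg (Finset.sum_nonneg fun _ _ => sq_nonneg _)
    (mul_nonneg hγ.le (frobeniusSq_nonneg _))
  -- Perturb along the residual `M` itself, so that the linear term is a multiple of its squared
  -- norm.
  have key : ∀ ε : ℝ, 0 ≤ 2 * (ε * frobeniusSq M) + ε ^ 2 * q := by
    intro ε
    have h1 := h (Set.mem_univ (ϑ + ε • M))
    simp only [Set.mem_ofPred_eq] at h1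
    rw [rlsCost_add, ← hM] at h1
    have h2 : ∑ i, ∑ j, (ε • M) i j * M i j = ε * frobeniusSq M := by
      simp only [frobeniusSq, Finset.mul_sum, Matrix.smul_apply, smul_eq_mul]
      exact Finset.sum_congr rfl fun i _ => Finset.sum_congr rfl fun j _ => by ring
    have h3 : (∑ s ∈ Finset.range t, ‖regress (ε • M) (z s)‖ ^ 2) + γ * frobeniusSq (ε • M)
        = ε ^ 2 * q := by
      simp only [hq, regress_smul, norm_smul, mul_pow, frobeniusSq, Matrix.smul_apply, smul_eq_mul,
        ← Finset.mul_sum, Real.norm_eq_abs, sq_abs]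
      ring
    rw [h2, h3] at h1
    linarith
  have h0 : frobeniusSq M = 0 := by
    by_contra hne
    have hpos : 0 < frobeniusSq M := lt_of_le_of_ne (frobeniusSq_nonneg _) (Ne.symm hne)
    -- This step makes the quadratic in `ε` negative unless `M` vanishes; the `+ 1` covers `q = 0`.
    have h4 := key (-(frobeniusSq M / (q + 1)))
    have h5 : (frobeniusSq M / (q + 1)) * (q + 1) = frobeniusSq M := by field_simp
    set e := frobeniusSq M / (q + 1)
    have he : 0 < e := by positivity
    rw [← h5] at h4
    nlinarith [mul_pos he he, mul_nonneg (mul_nonneg he.le he.le) hq0]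
  have hM0 : M = 0 := by
    ext i j
    have h6 := (Finset.sum_eq_zero_iff_of_nonneg
      (fun i _ => Finset.sum_nonneg fun j _ => sq_nonneg (M i j))).1 h0 i (Finset.mem_univ _)
    have h7 := (Finset.sum_eq_zero_iff_of_nonneg (fun j _ => sq_nonneg (M i j))).1 h6 j
      (Finset.mem_univ _)
    simpa using h7
  have hu := (Matrix.isUnit_iff_isUnit_det _).1 (isUnit_rlsGram hγ z t)
  have hM1 : rlsGram γ z t * ϑ = rlsCross z y t := sub_eq_zero.1 (hM.symm.trans hM0)
  rw [← hM1, ← Matrix.mul_assoc, Matrix.nonsing_inv_mul _ hu, Matrix.one_mul]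

/-- Comparing the cost of an estimate with that of the true parameter, also after shrinking the
estimation error. -/
theorem sum_sq_regress_le {γ : ℝ} (hγ : 0 < γ) (z : ℕ → Vec d) (w : ℕ → Vec n) (t : ℕ)
    {ϑ ϑs : Param d n} (h : IsMinOn (fun ϑ : Param d n =>
      (∑ s ∈ Finset.range t, ‖regress ϑs (z s) + w s - regress ϑ (z s)‖ ^ 2)
        + γ * frobeniusSq ϑ) Set.univ ϑ) {β : ℝ} (hβ : 0 ≤ β) (hβ1 : β ≤ 1) :
    ∑ s ∈ Finset.range t, ‖regress (β • (ϑ - ϑs)) (z s)‖ ^ 2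
      ≤ 2 * (∑ s ∈ Finset.range t, inner ℝ (w s) (regress (β • (ϑ - ϑs)) (z s)))
        + γ * frobeniusSq ϑs := by
  have h1 := h (Set.mem_univ ϑs)
  simp only [Set.mem_ofPred_eq, add_sub_cancel_left] at h1
  have h2 : ∀ s, ‖regress ϑs (z s) + w s - regress ϑ (z s)‖ ^ 2
      = ‖w s‖ ^ 2 - 2 * inner ℝ (w s) (regress (ϑ - ϑs) (z s))
        + ‖regress (ϑ - ϑs) (z s)‖ ^ 2 := by
    intro s
    rw [← norm_sub_sq_real, regress_sub]
    congr 2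
    abel
  simp only [h2, Finset.sum_add_distrib, Finset.sum_sub_distrib, ← Finset.mul_sum] at h1
  have h3 := mul_nonneg hγ.le (frobeniusSq_nonneg ϑ)
  simp only [regress_smul, norm_smul, mul_pow, inner_smul_right, ← Finset.mul_sum,
    Real.norm_eq_abs, sq_abs]
  have hA : 0 ≤ ∑ s ∈ Finset.range t, ‖regress (ϑ - ϑs) (z s)‖ ^ 2 :=
    Finset.sum_nonneg fun _ _ => sq_nonneg _
  have h4 := mul_nonneg hγ.le (frobeniusSq_nonneg ϑs)
  set A := ∑ s ∈ Finset.range t, ‖regress (ϑ - ϑs) (z s)‖ ^ 2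
  set N := ∑ s ∈ Finset.range t, inner ℝ (w s) (regress (ϑ - ϑs) (z s))
  have h5 : A ≤ 2 * N + γ * frobeniusSq ϑs := by linarith
  -- Shrinking is harmless: the energy scales with `β ^ 2` and the noise term only with `β`.
  calc β ^ 2 * A = β * (β * A) := by ring
    _ ≤ β * (1 * A) := by gcongr
    _ ≤ β * (2 * N + γ * frobeniusSq ϑs) := by rw [one_mul]; gcongr
    _ = 2 * (β * N) + β * (γ * frobeniusSq ϑs) := by ring
    _ ≤ 2 * (β * N) + 1 * (γ * frobeniusSq ϑs) := by gcongr
    _ = _ := by ring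

end LeastSquares

/-! ### Measurability and uniqueness of the closed loop -/

theorem measurable_regress {d n : ℕ} (ϑ : Param d n) : Measurable (regress ϑ) :=
  (LinearMap.continuous_of_finiteDimensional (Matrix.toEuclideanLin ϑᵀ)).measurable

theorem measurable_inducedNorm {d n : ℕ} (ϑs : Param d n) :
    Measurable fun a : Fin d → Fin n → ℝ => inducedNorm (Matrix.of a - ϑs) := by
  have h : Continuous fun A : Param d n => inducedNorm A := by
    have h1 : Continuous (LinearMap.toContinuousLinearMap.toLinearMap ∘ₗ
      (Matrix.toEuclideanLin (𝕜 := ℝ) (m := Fin d) (n := Fin n)).toLinearMap) :=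
      LinearMap.continuous_of_finiteDimensional _
    exact h1.nnnorm
  have h2 : Continuous fun a : Fin d → Fin n → ℝ => inducedNorm (Matrix.of a - ϑs) :=
    h.comp ((continuous_id (X := Param d n)).sub continuous_const)
  exact h2.measurable

theorem measurable_rls {Ω : Type*} {_ : MeasurableSpace Ω} {d n : ℕ} (γ : ℝ)
    {z : ℕ → Ω → Vec d} {y : ℕ → Ω → Vec n} {t : ℕ} (hz : ∀ s < t, Measurable (z s))
    (hy : ∀ s < t, Measurable (y s)) :
    Measurable fun ω i j => ((rlsGram γ (fun s => z s ω) t)⁻¹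
      * rlsCross (fun s => z s ω) (fun s => y s ω) t) i j := by
  have hz' : ∀ s < t, ∀ i, Measurable fun ω => z s ω i := fun s hs i => by
    have := hz s hs; fun_prop
  have hy' : ∀ s < t, ∀ i, Measurable fun ω => y s ω i := fun s hs i => by
    have := hy s hs; fun_prop
  have hG : Measurable fun ω i j => rlsGram γ (fun s => z s ω) t i j := by
    refine measurable_pi_iff.2 fun i => measurable_pi_iff.2 fun j => ?_
    simp only [rlsGram, Matrix.add_apply, Matrix.sum_apply, Matrix.vecMulVec_apply]
    refine measurable_const.add (Finset.measurable_sum _ fun s hs => ?_)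
    exact (hz' s (Finset.mem_range.1 hs) i).mul (hz' s (Finset.mem_range.1 hs) j)
  have hinv : ∀ i j, Measurable fun a : Fin d → Fin d → ℝ => (Matrix.of a)⁻¹ i j := by
    intro i j
    have hof : Continuous fun a : Fin d → Fin d → ℝ => Matrix.of a :=
      continuous_id (X := Matrix (Fin d) (Fin d) ℝ)
    have h1 : Continuous fun a : Fin d → Fin d → ℝ => (Matrix.of a).det := hof.matrix_det
    have h2 : Continuous fun a : Fin d → Fin d → ℝ => (Matrix.of a).adjugate i j :=
      (hof.matrix_adjugate).matrix_elem i j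
    -- Adjugate over determinant is measurable on all matrices, including singular ones, because
    -- real inversion with `0⁻¹ = 0` is measurable.
    simp only [Matrix.inv_def, Ring.inverse_eq_inv', Matrix.smul_apply, smul_eq_mul]
    exact h1.measurable.inv.mul h2.measurable
  refine measurable_pi_iff.2 fun i => measurable_pi_iff.2 fun j => ?_
  simp only [Matrix.mul_apply]
  refine Finset.measurable_sum _ fun k _ => ((hinv i k).comp hG).mul ?_
  simp only [rlsCross, Matrix.sum_apply, Matrix.vecMulVec_apply]
  refine Finset.measurable_sum _ fun s hs => ?_
  exact (hz' s (Finset.mem_range.1 hs) k).mul (hy' s (Finset.mem_range.1 hs) j)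

namespace System

variable {n m d q : ℕ} {sys : System n m d q}

theorem BorelMappings.measurable_g (hmeas : sys.BorelMappings) :
    Measurable fun p : (sys.𝕏 × sys.𝕌) × sys.𝕎 => sys.g p.1.1 p.1.2 p.2 := by
  refine Measurable.subtype_mk ?_
  have h0 : Measurable (Prod.fst : (sys.𝕏 × sys.𝕌) × sys.𝕎 → sys.𝕏 × sys.𝕌) := measurable_fst
  have h1 := hmeas.f.comp h0
  have h2 := (measurable_regress sys.θstar).comp (hmeas.ψ.comp h0)
  exact (h1.add h2).add (measurable_subtype_coe.comp measurable_snd)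

variable {Ω : Type*} {W : ℕ → Ω → sys.𝕎} {S : ℕ → Ω → sys.𝕊} {γ : ℝ} {ϑ₀ : Param d n} {x₀ : sys.𝕏}
  {X : ℕ → Ω → sys.𝕏} {U : ℕ → Ω → sys.𝕌} {θhat : ℕ → Ω → Param d n}

theorem rlsCost_eq (γ : ℝ) (x : ℕ → sys.𝕏) (u : ℕ → sys.𝕌) (t : ℕ) :
    sys.rlsCost γ x u t = fun ϑ => (∑ s ∈ Finset.range t,
      ‖((x (s + 1) : Vec n) - sys.f (x s) (u s)) - regress ϑ (sys.ψ (x s) (u s))‖ ^ 2)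
        + γ * frobeniusSq ϑ := by
  funext ϑ
  simp only [rlsCost]
  congr 1
  exact Finset.sum_congr rfl fun s _ => by rw [sub_right_comm]

theorem IsClosedLoop.estimate_eq (hγ : 0 < γ) (h : sys.IsClosedLoop W S γ ϑ₀ x₀ X U θhat)
    {t : ℕ} (ht : 1 ≤ t) (ω : Ω) :
    θhat t ω = (rlsGram γ (fun s => sys.ψ (X s ω) (U s ω)) t)⁻¹
      * rlsCross (fun s => sys.ψ (X s ω) (U s ω))
        (fun s => (X (s + 1) ω : Vec n) - sys.f (X s ω) (U s ω)) t := by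
  have h1 := h.estimate_argmin t ht ω
  rw [rlsCost_eq] at h1
  exact eq_rls_of_isMinOn hγ _ _ t h1

/-- Everything is determined by the noise once the minimiser is. This allows `η` to be chosen from
one closed loop and used for all others. -/
theorem IsClosedLoop.unique (hγ : 0 < γ) (h : sys.IsClosedLoop W S γ ϑ₀ x₀ X U θhat)
    {X' : ℕ → Ω → sys.𝕏} {U' : ℕ → Ω → sys.𝕌} {θhat' : ℕ → Ω → Param d n}
    (h' : sys.IsClosedLoop W S γ ϑ₀ x₀ X' U' θhat') (t : ℕ) (ω : Ω) :
    X t ω = X' t ω ∧ U t ω = U' t ω := by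
  induction t using Nat.strong_induction_on with
  | _ t ih =>
    cases t with
    | zero =>
      have h0 : X 0 ω = X' 0 ω := by rw [h.state_zero, h'.state_zero]
      exact ⟨h0, by rw [h.control_zero, h'.control_zero, h0]⟩
    | succ t =>
      have h0 : X (t + 1) ω = X' (t + 1) ω := by
        rw [h.state_succ, h'.state_succ, (ih t (by omega)).1, (ih t (by omega)).2]
      refine ⟨h0, ?_⟩
      have h1 : θhat t ω = θhat' t ω := by
        rcases Nat.eq_zero_or_pos t with rfl | ht
        · rw [h.estimate_zero, h'.estimate_zero]
        · rw [h.estimate_eq hγ ht, h'.estimate_eq hγ ht]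
          have hG : rlsGram γ (fun s => sys.ψ (X s ω) (U s ω)) t
              = rlsGram γ (fun s => sys.ψ (X' s ω) (U' s ω)) t := by
            unfold rlsGram
            congr 1
            refine Finset.sum_congr rfl fun s hs => ?_
            have hs := Finset.mem_range.1 hs
            beta_reduce
            rw [(ih s (by omega)).1, (ih s (by omega)).2]
          have hC : rlsCross (fun s => sys.ψ (X s ω) (U s ω))
              (fun s => (X (s + 1) ω : Vec n) - sys.f (X s ω) (U s ω)) t
              = rlsCross (fun s => sys.ψ (X' s ω) (U' s ω))
              (fun s => (X' (s + 1) ω : Vec n) - sys.f (X' s ω) (U' s ω)) t := by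
            unfold rlsCross
            refine Finset.sum_congr rfl fun s hs => ?_
            have hs := Finset.mem_range.1 hs
            beta_reduce
            rw [(ih s (by omega)).1, (ih s (by omega)).2, (ih (s + 1) (by omega)).1]
          rw [hG, hC]
      rw [h.control_succ, h'.control_succ, h0, h1]

theorem measurable_estimate_of (hmeas : sys.BorelMappings) (hγ : 0 < γ)
    (h : sys.IsClosedLoop W S γ ϑ₀ x₀ X U θhat) (t : ℕ)
    (hX : ∀ s ≤ t, Measurable[past W S s s] (X s))
    (hU : ∀ s < t, Measurable[past W S s (s + 1)] (U s)) :
    Measurable[past W S t t] fun ω i j => θhat t ω i j := by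
  rcases Nat.eq_zero_or_pos t with rfl | ht
  · simp only [h.estimate_zero]
    exact measurable_const
  · simp only [h.estimate_eq hγ ht]
    have hX' : ∀ s ≤ t, Measurable[past W S t t] (X s) := fun s hs =>
      (hX s hs).mono (past_mono hs hs) le_rfl
    have hU' : ∀ s < t, Measurable[past W S t t] (U s) := fun s hs =>
      (hU s hs).mono (past_mono hs.le hs) le_rfl
    refine measurable_rls γ (fun s hs => hmeas.ψ.comp ((hX' s hs.le).prodMk (hU' s hs)))
      (fun s hs => Measurable.sub (measurable_subtype_coe.comp (hX' (s + 1) hs))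
        (hmeas.f.comp ((hX' s hs.le).prodMk (hU' s hs))))

/-- The state at `t` sees both noises at indices below `t`, and the control sees in addition `S t`;
hence the two separate counters of `past`. -/
theorem IsClosedLoop.measurable_state_control (hmeas : sys.BorelMappings) (hγ : 0 < γ)
    (h : sys.IsClosedLoop W S γ ϑ₀ x₀ X U θhat) (t : ℕ) :
    Measurable[past W S t t] (X t) ∧ Measurable[past W S t (t + 1)] (U t) := by
  induction t using Nat.strong_induction_on with
  | _ t ih =>
    cases t with
    | zero =>
      have h0 : X 0 = fun _ => x₀ := funext h.state_zero
      have h1 : U 0 = fun ω => sys.α x₀ (S 0 ω) ϑ₀ := by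
        funext ω; rw [h.control_zero, h.state_zero]
      refine ⟨h0 ▸ measurable_const, ?_⟩
      rw [h1]
      exact hmeas.α.comp (measurable_const.prodMk
        ((measurable_past_right (Nat.zero_lt_succ 0)).prodMk
          (measurable_const (a := fun i j => ϑ₀ i j))))
    | succ t =>
      have h0 : X (t + 1) = fun ω => sys.g (X t ω) (U t ω) (W t ω) := funext (h.state_succ t)
      have h1 : U (t + 1) = fun ω => sys.α (X (t + 1) ω) (S (t + 1) ω) (θhat t ω) :=
        funext (h.control_succ t)
      have hX : Measurable[past W S (t + 1) (t + 1)] (X (t + 1)) := by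
        rw [h0]
        exact hmeas.measurable_g.comp (Measurable.prodMk (Measurable.prodMk
          ((ih t (by omega)).1.mono (past_mono (by omega) (by omega)) le_rfl)
          ((ih t (by omega)).2.mono (past_mono (by omega) (by omega)) le_rfl))
          (measurable_past_left (by omega)))
      refine ⟨hX, ?_⟩
      rw [h1]
      have hθ := measurable_estimate_of hmeas hγ h t (fun s hs => (ih s (by omega)).1)
        (fun s hs => (ih s (by omega)).2)
      exact hmeas.α.comp (Measurable.prodMk (hX.mono (past_mono le_rfl (by omega)) le_rfl)
        (Measurable.prodMk (measurable_past_right (by omega))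
          (hθ.mono (past_mono (by omega) (by omega)) le_rfl)))

theorem IsClosedLoop.measurable_state (hmeas : sys.BorelMappings) (hγ : 0 < γ)
    (h : sys.IsClosedLoop W S γ ϑ₀ x₀ X U θhat) {t a b : ℕ} (ha : t ≤ a) (hb : t ≤ b) :
    Measurable[past W S a b] (X t) :=
  (h.measurable_state_control hmeas hγ t).1.mono (past_mono ha hb) le_rfl

theorem IsClosedLoop.measurable_control (hmeas : sys.BorelMappings) (hγ : 0 < γ)
    (h : sys.IsClosedLoop W S γ ϑ₀ x₀ X U θhat) {t a b : ℕ} (ha : t ≤ a) (hb : t < b) :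
    Measurable[past W S a b] (U t) :=
  (h.measurable_state_control hmeas hγ t).2.mono (past_mono ha hb) le_rfl

theorem IsClosedLoop.measurable_estimate (hmeas : sys.BorelMappings) (hγ : 0 < γ)
    (h : sys.IsClosedLoop W S γ ϑ₀ x₀ X U θhat) {t a b : ℕ} (ha : t ≤ a) (hb : t ≤ b) :
    Measurable[past W S a b] fun ω i j => θhat t ω i j :=
  (measurable_estimate_of hmeas hγ h t
    (fun s _ => (h.measurable_state_control hmeas hγ s).1)
    (fun s _ => (h.measurable_state_control hmeas hγ s).2)).mono (past_mono ha hb) le_rfl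

theorem IsClosedLoop.measurable_regressor (hmeas : sys.BorelMappings) (hγ : 0 < γ)
    (h : sys.IsClosedLoop W S γ ϑ₀ x₀ X U θhat) {t a b : ℕ} (ha : t ≤ a) (hb : t < b) :
    Measurable[past W S a b] fun ω => sys.ψ (X t ω) (U t ω) :=
  hmeas.ψ.comp ((h.measurable_state hmeas hγ ha hb.le).prodMk
    (h.measurable_control hmeas hγ ha hb))

end System

/-! ### Sub-exponential growth of the regressors -/

/-- Sequences that are bounded by a multiple of every growing exponential. -/
def SubExpGrowth (a : ℕ → ℝ) : Prop :=
  ∀ κ : ℝ, 0 < κ → ∃ B : ℝ, 0 ≤ B ∧ ∀ t : ℕ, a t ≤ B * Real.exp (κ * t)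

namespace SubExpGrowth

variable {a b : ℕ → ℝ}

theorem mono (hb : SubExpGrowth b) (h : ∀ t, a t ≤ b t) : SubExpGrowth a := fun κ hκ => by
  obtain ⟨B, hB, h1⟩ := hb κ hκ
  exact ⟨B, hB, fun t => (h t).trans (h1 t)⟩

theorem const (c : ℝ) : SubExpGrowth fun _ => c := fun κ hκ =>
  ⟨|c|, abs_nonneg c, fun t => (le_abs_self c).trans
    (le_mul_of_one_le_right (abs_nonneg c) (Real.one_le_exp (by positivity)))⟩

theorem add (ha : SubExpGrowth a) (hb : SubExpGrowth b) : SubExpGrowth fun t => a t + b t :=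
  fun κ hκ => by
    obtain ⟨A, hA, h1⟩ := ha κ hκ
    obtain ⟨B, hB, h2⟩ := hb κ hκ
    exact ⟨A + B, add_nonneg hA hB, fun t => by rw [add_mul]; exact add_le_add (h1 t) (h2 t)⟩

theorem mul (ha : SubExpGrowth a) (hb : SubExpGrowth b) (hb0 : ∀ t, 0 ≤ b t) :
    SubExpGrowth fun t => a t * b t := fun κ hκ => by
  obtain ⟨A, hA, h1⟩ := ha (κ / 2) (half_pos hκ)
  obtain ⟨B, hB, h2⟩ := hb (κ / 2) (half_pos hκ)
  refine ⟨A * B, mul_nonneg hA hB, fun t => ?_⟩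
  calc a t * b t ≤ (A * Real.exp (κ / 2 * t)) * (B * Real.exp (κ / 2 * t)) :=
        mul_le_mul (h1 t) (h2 t) (hb0 t) (by positivity)
    _ = A * B * (Real.exp (κ / 2 * t) * Real.exp (κ / 2 * t)) := by ring
    _ = A * B * Real.exp (κ * t) := by rw [← Real.exp_add]; ring_nf

theorem pow (ha : SubExpGrowth a) (ha0 : ∀ t, 0 ≤ a t) (k : ℕ) : SubExpGrowth fun t => a t ^ k := by
  induction k with
  | zero => simpa using const 1
  | succ k ih => simpa only [pow_succ] using ih.mul ha ha0

theorem natCast : SubExpGrowth fun t => (t : ℝ) := fun κ hκ => by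
  refine ⟨κ⁻¹, by positivity, fun t => ?_⟩
  have h := Real.add_one_le_exp (κ * t)
  rw [inv_mul_eq_div, le_div_iff₀ hκ]
  linarith

theorem sum (ha : SubExpGrowth a) :
    SubExpGrowth fun t => ∑ s ∈ Finset.range t, a s := fun κ hκ => by
  obtain ⟨A, hA, h1⟩ := ha (κ / 2) (half_pos hκ)
  obtain ⟨B, hB, h2⟩ := natCast (κ / 2) (half_pos hκ)
  refine ⟨A * B, mul_nonneg hA hB, fun t => ?_⟩
  calc ∑ s ∈ Finset.range t, a s ≤ ∑ s ∈ Finset.range t, A * Real.exp (κ / 2 * t) := by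
        refine Finset.sum_le_sum fun s hs => (h1 s).trans ?_
        have : (s : ℝ) ≤ t := by exact_mod_cast (Finset.mem_range.1 hs).le
        gcongr
    _ = t * (A * Real.exp (κ / 2 * t)) := by simp
    _ ≤ (B * Real.exp (κ / 2 * t)) * (A * Real.exp (κ / 2 * t)) := by
        gcongr; exact h2 t
    _ = A * B * (Real.exp (κ / 2 * t) * Real.exp (κ / 2 * t)) := by ring
    _ = A * B * Real.exp (κ * t) := by rw [← Real.exp_add]; ring_nf

end SubExpGrowth

/-- Beyond some `R` this is the little-o condition; below `R`, monotonicity bounds the function by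
its value at `R ^ k`. -/
theorem ClassKInfSE.exists_le {k : ℕ} {χ : ℝ≥0 → ℝ≥0} (h : ClassKInfSE k χ) {κ : ℝ} (hκ : 0 < κ) :
    ∃ B : ℝ, 0 ≤ B ∧ ∀ r : ℝ≥0, (χ (r ^ k) : ℝ) ≤ B * Real.exp (κ * r) := by
  have h1 := h.2.def hκ
  obtain ⟨R, hR⟩ := eventually_atTop.1 h1
  refine ⟨max 1 (χ (R ^ k)), le_max_of_le_left zero_le_one, fun r => ?_⟩
  have hexp : (1 : ℝ) ≤ Real.exp (κ * r) := Real.one_le_exp (by positivity)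
  rcases le_total R r with hr | hr
  · have h2 := hR r hr
    rw [Real.norm_eq_abs, Real.norm_eq_abs, abs_of_nonneg r.coe_nonneg] at h2
    have h3 : (χ (r ^ k) : ℝ) ≤ Real.exp (κ * r) := by
      rcases (χ (r ^ k)).coe_nonneg.eq_or_lt with h0 | h0
      · rw [← h0]; positivity
      · rw [← Real.log_le_iff_le_exp h0]
        exact (le_abs_self _).trans h2
    exact h3.trans (le_mul_of_one_le_left (by positivity) (le_max_left _ _))
  · have h3 : χ (r ^ k) ≤ χ (R ^ k) := h.1.strictMono.monotone (by gcongr)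
    calc (χ (r ^ k) : ℝ) ≤ χ (R ^ k) := by exact_mod_cast h3
      _ ≤ max 1 (χ (R ^ k) : ℝ) := le_max_right _ _
      _ ≤ _ := le_mul_of_one_le_right (le_max_of_le_left zero_le_one) hexp

theorem AsympPolyBounded.exists_le {χ : ℝ≥0 → ℝ≥0} (h : AsympPolyBounded χ)
    (hb : ∀ R : ℝ≥0, BddAbove (χ '' Set.Iic R)) :
    ∃ (k : ℕ) (B : ℝ), 0 ≤ B ∧ ∀ r : ℝ≥0, (χ r : ℝ) ≤ B * (1 + (r : ℝ) ^ k) := by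
  obtain ⟨k, hk⟩ := h
  obtain ⟨C, hC⟩ := hk.bound
  obtain ⟨R, hR⟩ := eventually_atTop.1 hC
  obtain ⟨M, hM⟩ := hb R
  refine ⟨k, max |C| M, le_max_of_le_left (abs_nonneg C), fun r => ?_⟩
  have hrk : (0 : ℝ) ≤ (r : ℝ) ^ k := by positivity
  rcases le_total R r with hr | hr
  · have h2 := hR r hr
    rw [Real.norm_eq_abs, Real.norm_eq_abs, abs_of_nonneg hrk, abs_of_nonneg (χ r).coe_nonneg] at h2
    calc (χ r : ℝ) ≤ C * (r : ℝ) ^ k := h2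
      _ ≤ |C| * (1 + (r : ℝ) ^ k) := by
          have := le_abs_self C
          gcongr
          linarith
      _ ≤ _ := by gcongr; exact le_max_left _ _
  · have h3 : χ r ≤ M := hM ⟨r, hr, rfl⟩
    calc (χ r : ℝ) ≤ M := by exact_mod_cast h3
      _ ≤ max |C| (M : ℝ) := le_max_right _ _
      _ ≤ _ := le_mul_of_one_le_right (le_max_of_le_left (abs_nonneg C)) (by linarith)

theorem norm_le_mul_of_abs_le {n : ℕ} {x : Vec n} {b : ℝ} (hb : 0 ≤ b) (h : ∀ j, |x j| ≤ b) :
    ‖x‖ ≤ n * b := by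
  refine (pow_le_pow_iff_left₀ (norm_nonneg _) (by positivity) two_ne_zero).1 ?_
  rw [EuclideanSpace.norm_sq_eq]
  have hn : (n : ℝ) ≤ (n : ℝ) ^ 2 := by exact_mod_cast Nat.le_self_pow two_ne_zero n
  calc ∑ i, ‖x i‖ ^ 2 ≤ ∑ _i : Fin n, b ^ 2 :=
        Finset.sum_le_sum fun i _ => pow_le_pow_left₀ (norm_nonneg _) (h i) 2
    _ = n * b ^ 2 := by simp
    _ ≤ (n : ℝ) ^ 2 * b ^ 2 := by gcongr
    _ = _ := (mul_pow _ _ _).symm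

/-- The norm is at most `n` times the largest coordinate in absolute value, so the sub-Gaussian
bounds along coordinate axes suffice. The factor 2 anticipates a second moment of a function growing
like `exp`. -/
theorem exp_two_norm_le {n : ℕ} (x : Vec n) :
    Real.exp (2 * ‖x‖) ≤ 1 + ∑ j, (Real.exp (2 * n * x j) + Real.exp (-(2 * n) * x j)) := by
  have hnn : ∀ j, 0 ≤ Real.exp (2 * n * x j) + Real.exp (-(2 * n) * x j) := fun j => by positivity
  rcases (Finset.univ : Finset (Fin n)).eq_empty_or_nonempty with h0 | h0
  · have hx : ‖x‖ = 0 := by rw [EuclideanSpace.norm_eq, h0]; simp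
    rw [hx, h0]; simp
  · obtain ⟨j, -, hj⟩ := Finset.exists_max_image Finset.univ (fun j => |x j|) h0
    have h2 : ‖x‖ ≤ n * |x j| := norm_le_mul_of_abs_le (abs_nonneg _) fun i => hj i (Finset.mem_univ i)
    have h3 : Real.exp (2 * ‖x‖) ≤ Real.exp (2 * n * x j) + Real.exp (-(2 * n) * x j) := by
      rcases abs_cases (x j) with ⟨h, _⟩ | ⟨h, _⟩
      · rw [h] at h2
        have : Real.exp (2 * ‖x‖) ≤ Real.exp (2 * n * x j) := Real.exp_le_exp.2 (by linarith)
        linarith [Real.exp_pos (-(2 * n) * x j)]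
      · rw [h] at h2
        have : Real.exp (2 * ‖x‖) ≤ Real.exp (-(2 * n) * x j) := Real.exp_le_exp.2 (by linarith)
        linarith [Real.exp_pos (2 * n * x j)]
    have h4 := Finset.single_le_sum (f := fun j => Real.exp (2 * n * x j)
      + Real.exp (-(2 * n) * x j)) (fun j _ => hnn j) (Finset.mem_univ j)
    simp only at h4
    linarith

namespace System

variable {n m d q : ℕ} {sys : System n m d q} {Ω : Type*} {mΩ : MeasurableSpace Ω} {P : Measure Ω}
  {W : ℕ → Ω → sys.𝕎} {S : ℕ → Ω → sys.𝕊} {μw : Measure sys.𝕎} {μs : Measure sys.𝕊} {σw : ℝ≥0}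

theorem NoiseAssumption.lintegral_exp_inner_le (hnoise : sys.NoiseAssumption P W S μw μs σw)
    (i : ℕ) (v : Vec n) :
    ∫⁻ ω, ENNReal.ofReal (Real.exp (inner ℝ v (W i ω : Vec n))) ∂P
      ≤ ENNReal.ofReal (Real.exp (σw ^ 2 * ‖v‖ ^ 2 / 2)) * P Set.univ := by
  rcases eq_or_ne v 0 with rfl | hv
  · simp
  have hv' : ‖v‖ ≠ 0 := norm_ne_zero_iff.2 hv
  have hζ : ‖(‖v‖⁻¹ • v)‖ = 1 := by
    rw [norm_smul, norm_inv, norm_norm, inv_mul_cancel₀ hv']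
  have hsg := hnoise.subGaussian i _ hζ
  have h1 : ∀ ω, inner ℝ v (W i ω : Vec n) = ‖v‖ * inner ℝ (‖v‖⁻¹ • v) (W i ω : Vec n) := by
    intro ω
    rw [real_inner_smul_left, ← mul_assoc, mul_inv_cancel₀ hv', one_mul]
  rcases isEmpty_or_nonempty Ω with hΩ | hΩ
  · have : P = 0 := Measure.eq_zero_of_isEmpty P
    simp [this]
  have hP1 : IsProbabilityMeasure P := hnoise.iIndep_W.isProbabilityMeasure
  simp only [h1]
  rw [← ofReal_integral_eq_lintegral_ofReal (hsg.integrable_exp_mul _)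
    (ae_of_all _ fun _ => Real.exp_nonneg _), measure_univ, mul_one]
  refine ENNReal.ofReal_le_ofReal ((hsg.mgf_le ‖v‖).trans ?_)
  simp

theorem NoiseAssumption.lintegral_exp_two_norm_le [IsProbabilityMeasure P]
    (hnoise : sys.NoiseAssumption P W S μw μs σw) (i : ℕ) :
    ∫⁻ ω, ENNReal.ofReal (Real.exp (2 * ‖(W i ω : Vec n)‖)) ∂P
      ≤ 1 + ∑ _j : Fin n, (ENNReal.ofReal (Real.exp (σw ^ 2 * (2 * n) ^ 2 / 2))
        + ENNReal.ofReal (Real.exp (σw ^ 2 * (2 * n) ^ 2 / 2))) := by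
  have hWm : Measurable fun ω => (W i ω : Vec n) :=
    measurable_subtype_coe.comp (hnoise.measurable_W i)
  have hj : ∀ (c : ℝ) (j : Fin n), ∫⁻ ω, ENNReal.ofReal (Real.exp (c * (W i ω : Vec n) j)) ∂P
      ≤ ENNReal.ofReal (Real.exp (σw ^ 2 * c ^ 2 / 2)) := by
    intro c j
    have h := hnoise.lintegral_exp_inner_le i (EuclideanSpace.single j c)
    simpa [EuclideanSpace.inner_single_left, mul_comm] using h
  have hmj : ∀ (c : ℝ) (j : Fin n), Measurable fun ω =>
      ENNReal.ofReal (Real.exp (c * (W i ω : Vec n) j)) := fun c j => by fun_prop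
  calc ∫⁻ ω, ENNReal.ofReal (Real.exp (2 * ‖(W i ω : Vec n)‖)) ∂P
      ≤ ∫⁻ ω, (1 + ∑ j, (ENNReal.ofReal (Real.exp (2 * n * (W i ω : Vec n) j))
        + ENNReal.ofReal (Real.exp (-(2 * n) * (W i ω : Vec n) j)))) ∂P := by
        refine lintegral_mono fun ω => ?_
        refine (ENNReal.ofReal_le_ofReal (exp_two_norm_le _)).trans_eq ?_
        rw [ENNReal.ofReal_add zero_le_one (Finset.sum_nonneg fun j _ => by positivity),
          ENNReal.ofReal_one, ENNReal.ofReal_sum_of_nonneg fun j _ => by positivity]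
        congr 1
        exact Finset.sum_congr rfl fun j _ =>
          ENNReal.ofReal_add (Real.exp_nonneg _) (Real.exp_nonneg _)
    _ = 1 + ∑ j, (∫⁻ ω, ENNReal.ofReal (Real.exp (2 * n * (W i ω : Vec n) j)) ∂P
        + ∫⁻ ω, ENNReal.ofReal (Real.exp (-(2 * n) * (W i ω : Vec n) j)) ∂P) := by
        have hs := lintegral_finsetSum (μ := P) Finset.univ (f := fun (j : Fin n) ω =>
          ENNReal.ofReal (Real.exp (2 * n * (W i ω : Vec n) j))
            + ENNReal.ofReal (Real.exp (-(2 * n) * (W i ω : Vec n) j)))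
          fun j _ => (hmj _ j).add (hmj _ j)
        rw [lintegral_add_left measurable_const, hs]
        simp only [lintegral_const, measure_univ, mul_one]
        congr 1
        exact Finset.sum_congr rfl fun j _ => lintegral_add_left (hmj _ j) _
    _ ≤ _ := by
        gcongr with j
        · exact hj _ j
        · have h := hj (-(2 * n)) j
          rwa [neg_sq] at h

theorem NoiseAssumption.ae_exists_linear_bound [IsProbabilityMeasure P]
    (hnoise : sys.NoiseAssumption P W S μw μs σw) {σ : ℝ≥0 → ℝ≥0} (hσ : Continuous σ) {B : ℝ}
    (h : ∀ r : ℝ≥0, (σ r : ℝ) ≤ B * Real.exp r) :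
    ∀ᵐ ω ∂P, ∃ K : ℕ, ∀ i, σ ‖(W i ω : Vec n)‖₊ ≤ K * (i + 1) := by
  refine AdaptiveStabilisation.ae_exists_linear_bound (C := ENNReal.ofReal (B ^ 2) *
    (1 + ∑ _j : Fin n, (ENNReal.ofReal (Real.exp (σw ^ 2 * (2 * n) ^ 2 / 2))
        + ENNReal.ofReal (Real.exp (σw ^ 2 * (2 * n) ^ 2 / 2))))) (fun i => ?_) ?_ fun i => ?_
  · exact hσ.measurable.comp (measurable_nnnorm.comp
      (measurable_subtype_coe.comp (hnoise.measurable_W i)))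
  · refine ENNReal.mul_ne_top ENNReal.ofReal_ne_top ?_
    simp [ENNReal.mul_eq_top]
  · refine le_trans ?_ (mul_le_mul_right (hnoise.lintegral_exp_two_norm_le i) _)
    rw [← lintegral_const_mul' _ _ ENNReal.ofReal_ne_top]
    refine lintegral_mono fun ω => ?_
    rw [← ENNReal.ofReal_mul (sq_nonneg _), ← ENNReal.ofReal_coe_nnreal,
      ← ENNReal.ofReal_pow (NNReal.coe_nonneg _)]
    refine ENNReal.ofReal_le_ofReal ?_
    have h1 := h ‖(W i ω : Vec n)‖₊
    calc (σ ‖(W i ω : Vec n)‖₊ : ℝ) ^ 2 ≤ (B * Real.exp ‖(W i ω : Vec n)‖₊) ^ 2 := by gcongr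
      _ = _ := by rw [mul_pow, ← Real.exp_nat_mul]; simp

variable {γ : ℝ} {ϑ₀ : Param d n} {x₀ : sys.𝕏}
  {X : ℕ → Ω → sys.𝕏} {U : ℕ → Ω → sys.𝕌} {θhat : ℕ → Ω → Param d n}

omit mΩ in
theorem IsClosedLoop.state_eq_solution (h : sys.IsClosedLoop W S γ ϑ₀ x₀ X U θhat) (t : ℕ) (ω : Ω) :
    X t ω = sys.φ x₀ (fun s => U s ω) (fun s => W s ω) t := by
  induction t with
  | zero => exact h.state_zero ω
  | succ t ih => rw [h.state_succ, ih]; rfl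

omit mΩ in
theorem IsClosedLoop.norm_control_le (h : sys.IsClosedLoop W S γ ϑ₀ x₀ X U θhat) {umax : ℝ≥0}
    (hu : ∀ (x : sys.𝕏) (s : sys.𝕊) (ϑ : Param d n), ‖(sys.α x s ϑ : Vec m)‖₊ ≤ umax)
    (t : ℕ) (ω : Ω) : ‖(U t ω : Vec m)‖₊ ≤ umax := by
  cases t with
  | zero => rw [h.control_zero]; exact hu _ _ _
  | succ t => rw [h.control_succ]; exact hu _ _ _

/-- The control sum is linear in `t` and the noise sum almost surely at most quadratic, which is why
order 1 is asked of `χ₃` and order 2 of `χ₄`. -/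
theorem IsClosedLoop.ae_subExpGrowth_state [IsProbabilityMeasure P]
    (hnoise : sys.NoiseAssumption P W S μw μs σw) (hreach : sys.SubExpReachable)
    (hcontrol : sys.ConstrainedControls)
    (h : sys.IsClosedLoop W S γ ϑ₀ x₀ X U θhat) :
    ∀ᵐ ω ∂P, SubExpGrowth fun t => ‖(X t ω : Vec n)‖ := by
  obtain ⟨χ₁, χ₂, χ₃, χ₄, σ₁, σ₂, c₁, h1, h3, hσ2, h4, h2, hσ1, hb⟩ := hreach
  obtain ⟨umax, hu⟩ := hcontrol
  obtain ⟨B, hB, hσB⟩ := hσ2.exists_le one_pos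
  simp only [pow_one, one_mul] at hσB
  filter_upwards [hnoise.ae_exists_linear_bound hσ2.1.continuous hσB] with ω ⟨K, hK⟩
  have hg1 : SubExpGrowth fun t : ℕ => (χ₁ t : ℝ) := fun κ hκ => by
    obtain ⟨B, hB, hb⟩ := h1.exists_le hκ
    exact ⟨B, hB, fun t => by simpa using hb t⟩
  have hg3 : SubExpGrowth fun t : ℕ => (χ₃ (t * σ₁ umax) : ℝ) := fun κ hκ => by
    -- The rate is rescaled to absorb the factor `σ₁ umax`; the `+ 1` keeps the denominator
    -- positive.
    obtain ⟨B, hB, hb⟩ := h3.exists_le (κ := κ / (σ₁ umax + 1)) (by positivity)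
    refine ⟨B, hB, fun t => ?_⟩
    have := hb (t * σ₁ umax)
    rw [pow_one] at this
    refine this.trans (mul_le_mul_of_nonneg_left (Real.exp_le_exp.2 ?_) hB)
    rw [div_mul_eq_mul_div, div_le_iff₀ (by positivity)]
    push_cast
    have h0 : 0 ≤ κ * t := by positivity
    nlinarith
  have hg4 : SubExpGrowth fun t : ℕ => (χ₄ ((K * t) ^ 2) : ℝ) := fun κ hκ => by
    obtain ⟨B, hB, hb⟩ := h4.exists_le (κ := κ / (K + 1)) (by positivity)
    refine ⟨B, hB, fun t => ?_⟩
    have := hb (K * t)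
    refine this.trans (mul_le_mul_of_nonneg_left (Real.exp_le_exp.2 ?_) hB)
    rw [div_mul_eq_mul_div, div_le_iff₀ (by positivity)]
    push_cast
    have h0 : 0 ≤ κ * t := by positivity
    nlinarith
  -- The extra constant `‖x₀‖` covers time 0, where the reachability bound says nothing.
  refine ((((hg1.add (.const (χ₂ ‖(x₀ : Vec n)‖₊))).add hg3).add hg4).add (.const c₁)).add
    (.const ‖(x₀ : Vec n)‖) |>.mono fun t => ?_
  rcases Nat.eq_zero_or_pos t with rfl | ht
  · rw [h.state_zero]
    have : (0 : ℝ) ≤ χ₁ (0 : ℕ) + χ₂ ‖(x₀ : Vec n)‖₊ + χ₃ ((0 : ℕ) * σ₁ umax)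
      + χ₄ ((K * (0 : ℕ)) ^ 2) + c₁ := by positivity
    linarith
  · have hb' := hb t ht x₀ (fun s => U s ω) (fun s => W s ω)
    rw [← h.state_eq_solution] at hb'
    have e3 : ∑ i ∈ Finset.range t, σ₁ ‖(U i ω : Vec m)‖₊ ≤ t * σ₁ umax := by
      calc _ ≤ ∑ i ∈ Finset.range t, σ₁ umax := Finset.sum_le_sum fun i _ =>
            hσ1.strictMono.monotone (h.norm_control_le hu i ω)
        _ = _ := by simp
    have e4 : ∑ i ∈ Finset.range t, σ₂ ‖(W i ω : Vec n)‖₊ ≤ ((K : ℝ≥0) * t) ^ 2 := by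
      calc _ ≤ ∑ i ∈ Finset.range t, ((K * t : ℕ) : ℝ≥0) := by
            refine Finset.sum_le_sum fun i hi => (hK i).trans ?_
            have := Finset.mem_range.1 hi
            push_cast
            gcongr
            exact_mod_cast this
        _ = ((t * (K * t) : ℕ) : ℝ≥0) := by simp
        _ ≤ (((K * t) ^ 2 : ℕ) : ℝ≥0) := by
            refine Nat.cast_le.2 ?_
            calc t * (K * t) = K * t ^ 2 := by ring
              _ ≤ K ^ 2 * t ^ 2 := by gcongr; exact Nat.le_self_pow two_ne_zero K
              _ = _ := by ring
        _ = _ := by push_cast; ring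
    have hb2 : ‖(X t ω : Vec n)‖₊ ≤ χ₁ t + χ₂ ‖(x₀ : Vec n)‖₊ + χ₃ (t * σ₁ umax)
        + χ₄ ((K * t) ^ 2) + c₁ := by
      refine hb'.trans ?_
      gcongr
      · exact h3.1.strictMono.monotone e3
      · exact h4.1.strictMono.monotone e4
    have hb3 : ‖(X t ω : Vec n)‖ ≤ χ₁ t + χ₂ ‖(x₀ : Vec n)‖₊ + χ₃ (t * σ₁ umax)
        + χ₄ ((K * t) ^ 2) + c₁ := by exact_mod_cast hb2
    linarith [norm_nonneg (x₀ : Vec n)]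

theorem IsClosedLoop.ae_subExpGrowth_regressor [IsProbabilityMeasure P]
    (hnoise : sys.NoiseAssumption P W S μw μs σw) (hreach : sys.SubExpReachable)
    (hcontrol : sys.ConstrainedControls) (hbasis : sys.PolyBasis)
    (h : sys.IsClosedLoop W S γ ϑ₀ x₀ X U θhat) :
    ∀ᵐ ω ∂P, SubExpGrowth fun t => ‖sys.ψ (X t ω) (U t ω)‖ := by
  filter_upwards [h.ae_subExpGrowth_state hnoise hreach hcontrol] with ω hω
  obtain ⟨umax, hu⟩ := hcontrol
  obtain ⟨χ, hχ, hχb, hψ⟩ := hbasis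
  obtain ⟨k, B, hB, hk⟩ := hχ.exists_le hχb
  have hg := (SubExpGrowth.const B).mul ((SubExpGrowth.const 1).add
    ((hω.add (.const (umax : ℝ))).pow (fun t => by positivity) k)) (fun t => by positivity)
  refine hg.mono fun t => ?_
  have h1 := hψ (X t ω) (U t ω)
  calc ‖sys.ψ (X t ω) (U t ω)‖ ≤ χ _ := by exact_mod_cast h1
    _ ≤ _ := hk _
    _ ≤ _ := by
      gcongr
      have h3 : (NNReal.sqrt (‖(X t ω : Vec n)‖₊ ^ 2 + ‖(U t ω : Vec m)‖₊ ^ 2) : ℝ)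
          = √(‖(X t ω : Vec n)‖ ^ 2 + ‖(U t ω : Vec m)‖ ^ 2) := by
        rw [Real.coe_sqrt]; push_cast; rfl
      rw [h3]
      refine Real.sqrt_le_iff.2 ⟨by positivity, ?_⟩
      have h2 : ‖(U t ω : Vec m)‖ ≤ umax := by exact_mod_cast h.norm_control_le hu t ω
      nlinarith [norm_nonneg (X t ω : Vec n), norm_nonneg (U t ω : Vec m)]

end System

/-! ### Discretisation of the parameter space -/

section Grid

variable {d n : ℕ}

theorem norm_regress_le {A : Param d n} {a : ℝ} (ha : 0 ≤ a) (h : ∀ i j, |A i j| ≤ a) (z : Vec d) :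
    ‖regress A z‖ ≤ d * n * a * ‖z‖ := by
  have h1 : ∀ j, |regress A z j| ≤ d * (a * ‖z‖) := by
    intro j
    rw [regress_apply]
    refine (Finset.abs_sum_le_sum_abs _ _).trans ?_
    calc ∑ i, |A i j * z i| ≤ ∑ _i : Fin d, a * ‖z‖ := by
          refine Finset.sum_le_sum fun i _ => ?_
          rw [abs_mul]
          exact mul_le_mul (h i j) (PiLp.norm_apply_le z i) (abs_nonneg _) ha
      _ = _ := by simp
  calc ‖regress A z‖ ≤ n * (d * (a * ‖z‖)) := norm_le_mul_of_abs_le (by positivity) h1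
    _ = _ := by ring

theorem inducedNorm_le {A : Param d n} {a : ℝ} (ha : 0 ≤ a) (h : ∀ i j, |A i j| ≤ a) :
    (inducedNorm A : ℝ) ≤ n * d * a := by
  refine ContinuousLinearMap.opNorm_le_bound _ (by positivity) fun v => ?_
  exact norm_regress_le (A := Aᵀ) ha (fun i j => h j i) v

/-- The grid points with mesh `1 / l` in the cube of radius `r`, up to the factor `1 / l`. -/
noncomputable def grid (d n : ℕ) (r : ℝ) (l : ℕ) : Finset (Fin d → Fin n → ℤ) :=
  Fintype.piFinset fun _ => Fintype.piFinset fun _ => Finset.Icc (-⌈r * l⌉) ⌈r * l⌉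

/-- The parameter that belongs to a grid point. -/
noncomputable def gridPoint (l : ℕ) (k : Fin d → Fin n → ℤ) : Param d n :=
  Matrix.of fun i j => (k i j : ℝ) / l

theorem card_grid_le {r : ℝ} (hr : 0 < r) (l : ℕ) :
    ((grid d n r l).card : ℝ) ≤ (2 * r * l + 3) ^ (n * d) := by
  have h0 : 0 ≤ ⌈r * l⌉ := Int.ceil_nonneg (by positivity)
  have h1 : ((Finset.Icc (-⌈r * l⌉) ⌈r * l⌉).card : ℝ) ≤ 2 * r * l + 3 := by
    rw [Int.card_Icc]
    have h2 : ((⌈r * l⌉ + 1 - -⌈r * l⌉).toNat : ℤ) = ⌈r * l⌉ + 1 - -⌈r * l⌉ :=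
      Int.toNat_of_nonneg (by omega)
    have h3 : ((⌈r * l⌉ + 1 - -⌈r * l⌉).toNat : ℝ) = ⌈r * l⌉ + 1 - -⌈r * l⌉ := by
      exact_mod_cast h2
    rw [h3]
    linarith [Int.ceil_lt_add_one (r * l)]
  simp only [grid, Fintype.card_piFinset_const, Nat.cast_pow, ← pow_mul]
  gcongr

/-- Scale `E` so that its largest entry has modulus exactly `r`, then round entrywise by the floor.
Since `1 / l ≤ r / 2`, that entry keeps modulus at least `r / 2`. -/
theorem exists_grid_point {r : ℝ} (hr : 0 < r) {l : ℕ} (hl : 2 ≤ r * l) {E : Param d n}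
    {i₀ : Fin d} {j₀ : Fin n} (hE : r ≤ |E i₀ j₀|) :
    ∃ β : ℝ, 0 ≤ β ∧ β ≤ 1 ∧ ∃ k ∈ grid d n r l, (∃ i j, r / 2 ≤ |gridPoint l k i j|) ∧
      ∀ i j, |(β • E) i j| ≤ r ∧ |gridPoint l k i j - (β • E) i j| ≤ 1 / l := by
  have hl0 : (0 : ℝ) < l := pos_of_mul_pos_right (by linarith) hr.le
  obtain ⟨⟨i, j⟩, -, hij⟩ := Finset.exists_max_image (Finset.univ : Finset (Fin d × Fin n))
    (fun p => |E p.1 p.2|) ⟨(i₀, j₀), Finset.mem_univ _⟩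
  have hM : r ≤ |E i j| := hE.trans (hij (i₀, j₀) (Finset.mem_univ _))
  have hM0 : 0 < |E i j| := hr.trans_le hM
  have hle : ∀ i' j', |((r / |E i j|) • E) i' j'| ≤ r := by
    intro i' j'
    rw [Matrix.smul_apply, smul_eq_mul, abs_mul, abs_of_nonneg (by positivity),
      div_mul_eq_mul_div, div_le_iff₀ hM0]
    exact mul_le_mul_of_nonneg_left (hij (i', j') (Finset.mem_univ _)) hr.le
  have heq : |((r / |E i j|) • E) i j| = r := by
    rw [Matrix.smul_apply, smul_eq_mul, abs_mul, abs_of_nonneg (by positivity),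
      div_mul_cancel₀ _ hM0.ne']
  set Λ := (r / |E i j|) • E with hΛ
  have hfl : ∀ i' j', |gridPoint l (fun i j => ⌊Λ i j * l⌋) i' j' - Λ i' j'| ≤ 1 / l := by
    intro i' j'
    have h1 := Int.floor_le (Λ i' j' * l)
    have h2 := (Int.lt_floor_add_one (Λ i' j' * l)).le
    have h3 : gridPoint l (fun i j => ⌊Λ i j * l⌋) i' j' - Λ i' j'
        = (⌊Λ i' j' * l⌋ - Λ i' j' * l) / l := by
      simp only [gridPoint, Matrix.of_apply]; field_simp
    rw [h3, abs_div, abs_of_pos hl0]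
    gcongr
    rw [abs_le]
    constructor <;> linarith
  refine ⟨r / |E i j|, by positivity, (div_le_one hM0).2 hM, fun i j => ⌊Λ i j * l⌋, ?_,
    ⟨i, j, ?_⟩, fun i' j' => ⟨hle i' j', hfl i' j'⟩⟩
  · simp only [grid, Fintype.mem_piFinset, Finset.mem_Icc]
    intro i' j'
    have h1 := abs_le.1 (hle i' j')
    have h2 := Int.le_ceil (r * l)
    constructor
    · rw [Int.le_floor]
      push_cast
      nlinarith [h1.1]
    · have h3 : Λ i' j' * l ≤ r * l := by nlinarith [h1.2]
      exact_mod_cast ((Int.floor_le _).trans h3).trans h2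
  · have h1 := hfl i j
    have h2 : 1 / (l : ℝ) ≤ r / 2 := by
      rw [div_le_div_iff₀ hl0 two_pos]; linarith
    have h3 := abs_sub_abs_le_abs_sub (Λ i j) (gridPoint l (fun i j => ⌊Λ i j * l⌋) i j)
    rw [abs_sub_comm, heq] at h3
    linarith

/-- Cost of rounding a direction: expand around `Λ`, apply Cauchy–Schwarz, and use `h ≤ 1` to make
the quadratic remainder linear in `h`. -/
theorem sum_sq_sub_two_inner_le (z : ℕ → Vec d) (w : ℕ → Vec n) (t : ℕ) {Λ Λ' : Param d n} {r h : ℝ}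
    (hr : 0 ≤ r) (hh : 0 ≤ h) (hh1 : h ≤ 1) (hΛ : ∀ i j, |Λ i j| ≤ r)
    (hΛ' : ∀ i j, |Λ' i j - Λ i j| ≤ h) :
    (∑ s ∈ Finset.range t, ‖regress Λ' (z s)‖ ^ 2)
        - 2 * ∑ s ∈ Finset.range t, inner ℝ (w s) (regress Λ' (z s))
      ≤ (∑ s ∈ Finset.range t, ‖regress Λ (z s)‖ ^ 2)
        - 2 * (∑ s ∈ Finset.range t, inner ℝ (w s) (regress Λ (z s)))
        + h * (((d * n) ^ 2 * (2 * r + 1) + 2 * (d * n))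
          * ∑ s ∈ Finset.range t, (‖z s‖ ^ 2 + ‖w s‖ * ‖z s‖)) := by
  simp only [Finset.mul_sum, ← Finset.sum_sub_distrib, ← Finset.sum_add_distrib]
  refine Finset.sum_le_sum fun s _ => ?_
  have h1 : regress Λ' (z s) = regress Λ (z s) + regress (Λ' - Λ) (z s) := by
    rw [← regress_add]; congr 1; abel
  have h2 := norm_regress_le hr hΛ (z s)
  have h3 := norm_regress_le (A := Λ' - Λ) hh hΛ' (z s)
  rw [h1, inner_add_right, norm_add_sq_real]
  have h4 := real_inner_le_norm (regress Λ (z s)) (regress (Λ' - Λ) (z s))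
  have h5 := neg_le_of_abs_le (abs_real_inner_le_norm (w s) (regress (Λ' - Λ) (z s)))
  set a := ‖regress Λ (z s)‖
  set b := ‖regress (Λ' - Λ) (z s)‖
  have ha : 0 ≤ a := norm_nonneg _
  have hb : 0 ≤ b := norm_nonneg _
  have hz : 0 ≤ ‖z s‖ := norm_nonneg _
  have hw : 0 ≤ ‖w s‖ := norm_nonneg _
  set D : ℝ := d * n with hD
  have hD0 : 0 ≤ D := by positivity
  have e1 : a * b ≤ (D * r * ‖z s‖) * (D * h * ‖z s‖) := mul_le_mul h2 h3 hb (by positivity)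
  have e2 : b ^ 2 ≤ h * (D ^ 2 * ‖z s‖ ^ 2) := by
    calc b ^ 2 ≤ (D * h * ‖z s‖) ^ 2 := by gcongr
      _ = h * (h * (D ^ 2 * ‖z s‖ ^ 2)) := by ring
      _ ≤ h * (1 * (D ^ 2 * ‖z s‖ ^ 2)) := by gcongr
      _ = _ := by ring
  have e3 : ‖w s‖ * b ≤ ‖w s‖ * (D * h * ‖z s‖) := by gcongr
  have e4 : 0 ≤ h * (D ^ 2 * (2 * r + 1) * (‖w s‖ * ‖z s‖)) := by positivity
  have e5 : 0 ≤ h * (2 * D * ‖z s‖ ^ 2) := by positivity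
  nlinarith

end Grid

namespace System

/-! ### Consistency of the estimates -/

variable {n m d q : ℕ} {sys : System n m d q} {Ω : Type*} {mΩ : MeasurableSpace Ω} {P : Measure Ω}
  {W : ℕ → Ω → sys.𝕎} {S : ℕ → Ω → sys.𝕊} {μw : Measure sys.𝕎} {μs : Measure sys.𝕊} {σw : ℝ≥0}
  {γ : ℝ} {ϑ₀ : Param d n} {x₀ : sys.𝕏}
  {X : ℕ → Ω → sys.𝕏} {U : ℕ → Ω → sys.𝕌} {θhat : ℕ → Ω → Param d n}

theorem NoiseAssumption.iIndep_noiseSigma (hnoise : sys.NoiseAssumption P W S μw μs σw) :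
    iIndep (noiseSigma W S) P :=
  AdaptiveStabilisation.iIndep_noiseSigma hnoise.iIndep_W hnoise.iIndep_S hnoise.indep_W_S

/-- The regressor at `s` is fixed before `W s` is drawn, and the subtracted square is exactly the
compensator of the sub-Gaussian moment bound, so each step has conditional moment at most 1. -/
theorem IsClosedLoop.lintegral_exp_noise_sum_le [IsProbabilityMeasure P]
    (hmeas : sys.BorelMappings) (hγ : 0 < γ) (hnoise : sys.NoiseAssumption P W S μw μs σw)
    (h : sys.IsClosedLoop W S γ ϑ₀ x₀ X U θhat) (Λ : Param d n) (κ : ℝ) (t : ℕ) :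
    ∫⁻ ω, ENNReal.ofReal (Real.exp (∑ s ∈ Finset.range t,
      (κ * inner ℝ (W s ω : Vec n) (regress Λ (sys.ψ (X s ω) (U s ω)))
        - σw ^ 2 * κ ^ 2 / 2 * ‖regress Λ (sys.ψ (X s ω) (U s ω))‖ ^ 2))) ∂P ≤ 1 := by
  have hz : ∀ s {a b : ℕ}, s ≤ a → s < b →
      Measurable[past W S a b] fun ω => regress Λ (sys.ψ (X s ω) (U s ω)) := fun s a b ha hb =>
    (measurable_regress Λ).comp (h.measurable_regressor hmeas hγ ha hb)
  have key := lintegral_exp_sum_le (P := P) (ℱ := fun s => past W S s (s + 1))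
    (fun s s' hs => past_mono hs (by omega))
    (R := fun s ω => κ * inner ℝ (W s ω : Vec n) (regress Λ (sys.ψ (X s ω) (U s ω)))
        - σw ^ 2 * κ ^ 2 / 2 * ‖regress Λ (sys.ψ (X s ω) (U s ω))‖ ^ 2) (ρ := 1) ?_ ?_ t
  · simpa using key
  · intro s
    have h1 := hz s (a := s + 1) (b := s + 1 + 1) (by omega) (by omega)
    have h2 : Measurable[past W S (s + 1) (s + 1 + 1)] fun ω => (W s ω : Vec n) :=
      measurable_subtype_coe.comp (measurable_past_left (by omega))
    have hG : Measurable fun p : Vec n × Vec n =>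
        κ * inner ℝ p.1 p.2 - σw ^ 2 * κ ^ 2 / 2 * ‖p.2‖ ^ 2 := by fun_prop
    have h3 : Measurable[past W S (s + 1) (s + 1 + 1)]
      fun ω => ((W s ω : Vec n), regress Λ (sys.ψ (X s ω) (U s ω))) := h2.prodMk h1
    have h4 := hG.comp h3
    simp only [Function.comp_def] at h4
    exact h4
  · intro s Y hY
    have hF : Measurable fun p : Vec n × sys.𝕎 =>
        ENNReal.ofReal (Real.exp (κ * inner ℝ (p.2 : Vec n) p.1
          - σw ^ 2 * κ ^ 2 / 2 * ‖p.1‖ ^ 2)) := by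
      have h1 : Measurable fun p : Vec n × sys.𝕎 => (p.2 : Vec n) :=
        measurable_subtype_coe.comp measurable_snd
      have h2 : Measurable fun p : Vec n × sys.𝕎 => p.1 := measurable_fst
      exact ENNReal.measurable_ofReal.comp (Real.measurable_exp.comp
        (((h1.inner h2).const_mul κ).sub ((h2.norm.pow_const 2).const_mul _)))
    have h1 := lintegral_mul_of_indep (P := P)
      (past_le hnoise.measurable_W hnoise.measurable_S s (s + 1)) hY (hz s le_rfl (by omega))
      (hnoise.measurable_W s)
      (indep_past_left hnoise.measurable_W hnoise.measurable_S hnoise.iIndep_noiseSigma le_rfl) hF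
    simp only at h1
    rw [h1, one_mul]
    refine lintegral_mono fun ω => mul_le_of_le_one_right' ?_
    set v := regress Λ (sys.ψ (X s ω) (U s ω))
    have h3 := lintegral_map (μ := P) (hF.comp (measurable_prodMk_left (x := v)))
      (hnoise.measurable_W s)
    simp only [Function.comp_def] at h3
    rw [h3]
    have h2 : ∀ ω', ENNReal.ofReal (Real.exp (κ * inner ℝ (W s ω' : Vec n) v
        - σw ^ 2 * κ ^ 2 / 2 * ‖v‖ ^ 2))
        = ENNReal.ofReal (Real.exp (inner ℝ (κ • v) (W s ω' : Vec n)))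
          * ENNReal.ofReal (Real.exp (-(σw ^ 2 * κ ^ 2 / 2 * ‖v‖ ^ 2))) := by
      intro ω'
      rw [← ENNReal.ofReal_mul (Real.exp_nonneg _), ← Real.exp_add, real_inner_smul_left,
        real_inner_comm, sub_eq_add_neg]
    simp only [h2]
    rw [lintegral_mul_const' _ _ ENNReal.ofReal_ne_top]
    refine (mul_le_mul_left (hnoise.lintegral_exp_inner_le s (κ • v)) _).trans ?_
    rw [measure_univ, mul_one, ← ENNReal.ofReal_mul (Real.exp_nonneg _), ← Real.exp_add, norm_smul,
      mul_pow, Real.norm_eq_abs, sq_abs]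
    refine (ENNReal.ofReal_le_ofReal (le_of_eq ?_)).trans_eq ENNReal.ofReal_one
    rw [Real.exp_eq_one_iff]
    ring

/-- Take `ζ` to be the normalised column `j` of `Λ`; coordinate `j` of the regression is its pairing
with `z`, up to the column norm, which is at least `r`. -/
theorem sq_mul_sq_inner_le {Λ : Param d n} {r : ℝ} {i : Fin d} {j : Fin n} (hr : 0 < r)
    (hΛ : r ≤ |Λ i j|) :
    ∃ ζ : Vec d, ‖ζ‖ = 1 ∧ ∀ z, r ^ 2 * |inner ℝ ζ z| ^ 2 ≤ ‖regress Λ z‖ ^ 2 := by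
  set v : Vec d := WithLp.toLp 2 fun i => Λ i j with hv
  have h1 : r ≤ ‖v‖ := hΛ.trans (PiLp.norm_apply_le v i)
  have h0 : 0 < ‖v‖ := hr.trans_le h1
  refine ⟨‖v‖⁻¹ • v, by rw [norm_smul, norm_inv, norm_norm, inv_mul_cancel₀ h0.ne'], fun z => ?_⟩
  have h2 : inner ℝ v z = regress Λ z j := by
    rw [regress_apply]
    simp [hv, PiLp.inner_apply, mul_comm]
  have h3 : |inner ℝ v z| ≤ ‖regress Λ z‖ := h2 ▸ PiLp.norm_apply_le (regress Λ z) j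
  have h4 : r * |inner ℝ (‖v‖⁻¹ • v) z| ≤ ‖regress Λ z‖ := by
    rw [real_inner_smul_left, abs_mul, abs_of_nonneg (inv_nonneg.2 h0.le), ← mul_assoc]
    calc r * ‖v‖⁻¹ * |inner ℝ v z| ≤ 1 * |inner ℝ v z| := by
          gcongr
          rwa [← div_eq_mul_inv, div_le_one h0]
      _ ≤ _ := by rwa [one_mul]
  rw [← mul_pow]
  gcongr

/-- Under global excitation, the exponential moment of the excitation in a fixed direction decays
geometrically. -/
theorem IsClosedLoop.lintegral_exp_neg_excitation_le [IsProbabilityMeasure P]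
    (hmeas : sys.BorelMappings) (hγ : 0 < γ) (hnoise : sys.NoiseAssumption P W S μw μs σw)
    (h : sys.IsClosedLoop W S γ ϑ₀ x₀ X U θhat) {c p : ℝ}
    (hexc : sys.GloballyExcited μw μs c p) {r : ℝ} (hr : 0 < r) {Λ : Param d n} {i : Fin d}
    {j : Fin n} (hΛ : r ≤ |Λ i j|) (hc : 0 < c) (t : ℕ) :
    ∫⁻ ω, ENNReal.ofReal (Real.exp (∑ s ∈ Finset.range t,
      -‖regress Λ (sys.ψ (X (s + 1) ω) (U (s + 1) ω))‖ ^ 2)) ∂P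
      ≤ ENNReal.ofReal (Real.exp (-(p * (1 - Real.exp (-(r ^ 2 * c))))) ) ^ t := by
  have hz : ∀ s {a b : ℕ}, s ≤ a → s < b →
      Measurable[past W S a b] fun ω => regress Λ (sys.ψ (X s ω) (U s ω)) := fun s a b ha hb =>
    (measurable_regress Λ).comp (h.measurable_regressor hmeas hγ ha hb)
  have hμs : IsProbabilityMeasure μs := by
    rw [← hnoise.law_S 0]; exact Measure.isProbabilityMeasure_map (hnoise.measurable_S 0).aemeasurable
  have hμw : IsProbabilityMeasure μw := by
    rw [← hnoise.law_W 0]; exact Measure.isProbabilityMeasure_map (hnoise.measurable_W 0).aemeasurable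
  obtain ⟨ζ, hζ, hζle⟩ := sq_mul_sq_inner_le hr hΛ
  refine lintegral_exp_sum_le (P := P) (ℱ := fun s => past W S s (s + 1))
    (fun s s' hs => past_mono hs (by omega)) (fun s => ?_) (fun s Y hY => ?_) t
  · have hG : Measurable fun v : Vec n => -‖v‖ ^ 2 := by fun_prop
    exact hG.comp (hz (s + 1) (a := s + 1) (b := s + 1 + 1) le_rfl (by omega))
  · set reg : ((sys.𝕏 × sys.𝕌) × (Fin d → Fin n → ℝ)) × (sys.𝕊 × sys.𝕎) → Vec d := fun a =>
      sys.ψ (sys.g a.1.1.1 a.1.1.2 a.2.2)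
        (sys.α (sys.g a.1.1.1 a.1.1.2 a.2.2) a.2.1 (Matrix.of a.1.2)) with hreg
    have hregm : Measurable reg := by
      have hg : Measurable fun a : ((sys.𝕏 × sys.𝕌) × (Fin d → Fin n → ℝ)) × (sys.𝕊 × sys.𝕎) =>
          sys.g a.1.1.1 a.1.1.2 a.2.2 := hmeas.measurable_g.comp
        ((measurable_fst.comp measurable_fst).prodMk (measurable_snd.comp measurable_snd))
      exact hmeas.ψ.comp (hg.prodMk (hmeas.α.comp (hg.prodMk
        ((measurable_fst.comp measurable_snd).prodMk (measurable_snd.comp measurable_fst)))))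
    have hF : Measurable fun a => ENNReal.ofReal (Real.exp (-‖regress Λ (reg a)‖ ^ 2)) :=
      ENNReal.measurable_ofReal.comp (Real.measurable_exp.comp
        (((measurable_regress Λ).comp hregm).norm.pow_const 2).neg)
    -- The control at `s + 1` uses the estimate at `s`, which does not see `W s` or `S (s + 1)`.
    -- This delay lets the parameter be frozen in the excitation condition.
    have hA : Measurable[past W S s (s + 1)] fun ω =>
        ((X s ω, U s ω), (fun i j => θhat s ω i j : Fin d → Fin n → ℝ)) :=
      ((h.measurable_state hmeas hγ le_rfl (by omega)).prodMk
        (h.measurable_control hmeas hγ le_rfl (by omega))).prodMk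
        (h.measurable_estimate hmeas hγ le_rfl (by omega))
    have h1 := lintegral_mul_of_indep (P := P)
      (past_le hnoise.measurable_W hnoise.measurable_S s (s + 1)) hY hA
      ((hnoise.measurable_S (s + 1)).prodMk (hnoise.measurable_W s))
      (indep_past_pair hnoise.measurable_W hnoise.measurable_S hnoise.iIndep_noiseSigma le_rfl
        le_rfl) hF
    rw [map_pair hnoise.measurable_W hnoise.measurable_S hnoise.iIndep_noiseSigma, hnoise.law_S,
      hnoise.law_W] at h1
    have h2 : ∀ ω, regress Λ (sys.ψ (X (s + 1) ω) (U (s + 1) ω))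
        = regress Λ (reg (((X s ω, U s ω), fun i j => θhat s ω i j), (S (s + 1) ω, W s ω))) := by
      intro ω
      rw [h.control_succ, h.state_succ]
      rfl
    simp only [h2]
    rw [h1, mul_comm, ← lintegral_mul_const' _ _ ENNReal.ofReal_ne_top]
    refine lintegral_mono fun ω => mul_le_mul_right ?_ _
    set a : (sys.𝕏 × sys.𝕌) × (Fin d → Fin n → ℝ) := ((X s ω, U s ω), fun i j => θhat s ω i j)
    -- Excitation is applied at the one-step prediction, to which `W s` is added to give the next
    -- state.
    have hE := hexc (θhat s ω) ⟨_, sys.nominal_mem (X s ω) (U s ω)⟩ (Set.mem_univ _) ζ hζ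
    set E : Set (sys.𝕊 × sys.𝕎) := {sw | c ≤ |inner ℝ ζ (reg (a, sw))| ^ 2} with hEdef
    have hEm : MeasurableSet E := by
      have hm : Measurable fun sw : sys.𝕊 × sys.𝕎 => reg (a, sw) :=
        hregm.comp measurable_prodMk_left
      have hm2 : Measurable fun sw : sys.𝕊 × sys.𝕎 => |inner ℝ ζ (reg (a, sw))| ^ 2 :=
        ((measurable_const.inner hm).abs).pow_const 2
      exact measurableSet_le measurable_const hm2
    have hpE : p ≤ (μs.prod μw).real E := by
      refine hE.trans (measureReal_mono ?_)
      rintro sw ⟨_, hsw⟩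
      exact hsw
    set η := Real.exp (-(r ^ 2 * c))
    have hη : η ≤ 1 := Real.exp_le_one_iff.2 (by have := mul_pos (pow_pos hr 2) hc; linarith)
    -- The integrand is at most `η` on `E` and at most 1 elsewhere; then `1 - x ≤ exp (-x)`.
    calc ∫⁻ sw, ENNReal.ofReal (Real.exp (-‖regress Λ (reg (a, sw))‖ ^ 2)) ∂(μs.prod μw)
        ≤ ∫⁻ sw, ENNReal.ofReal (1 - E.indicator (fun _ => 1 - η) sw) ∂(μs.prod μw) := by
          refine lintegral_mono fun sw => ENNReal.ofReal_le_ofReal ?_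
          by_cases hsw : sw ∈ E
          · rw [Set.indicator_of_mem hsw, sub_sub_cancel]
            refine Real.exp_le_exp.2 (neg_le_neg (le_trans ?_ (hζle _)))
            exact mul_le_mul_of_nonneg_left hsw (sq_nonneg r)
          · rw [Set.indicator_of_notMem hsw, sub_zero, Real.exp_le_one_iff]
            exact neg_nonpos.2 (sq_nonneg _)
      _ = ENNReal.ofReal (∫ sw, (1 - E.indicator (fun _ => 1 - η) sw) ∂(μs.prod μw)) := by
          rw [ofReal_integral_eq_lintegral_ofReal]
          · exact (integrable_const _).sub ((integrable_const _).indicator hEm)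
          · refine ae_of_all _ fun sw => ?_
            have := Real.exp_nonneg (-(r ^ 2 * c))
            by_cases hsw : sw ∈ E
            · simpa [Set.indicator_of_mem hsw] using this
            · simp [Set.indicator_of_notMem hsw]
      _ = ENNReal.ofReal (1 - (μs.prod μw).real E * (1 - η)) := by
          rw [integral_sub (integrable_const _) ((integrable_const _).indicator hEm),
            integral_indicator_const _ hEm]
          simp
      _ ≤ ENNReal.ofReal (Real.exp (-(p * (1 - η)))) := by
          refine ENNReal.ofReal_le_ofReal ?_
          have h3 := Real.add_one_le_exp (-(p * (1 - η)))
          have h4 : p * (1 - η) ≤ (μs.prod μw).real E * (1 - η) :=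
            mul_le_mul_of_nonneg_right hpE (by linarith)
          linarith

end System

/-! ### Deviation bounds and consistency of the estimates -/

namespace System

variable {n m d q : ℕ} {sys : System n m d q} {Ω : Type*} {mΩ : MeasurableSpace Ω} {P : Measure Ω}
  {W : ℕ → Ω → sys.𝕎} {S : ℕ → Ω → sys.𝕊} {μw : Measure sys.𝕎} {μs : Measure sys.𝕊} {σw : ℝ≥0}
  {γ : ℝ} {ϑ₀ : Param d n} {x₀ : sys.𝕏}
  {X : ℕ → Ω → sys.𝕏} {U : ℕ → Ω → sys.𝕌} {θhat : ℕ → Ω → Param d n}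

/-- If the energy `Q` is large yet dominated by the noise correlation `N`, then the compensated
noise sum is large. Thus a bad event reduces to two Chernoff events. -/
theorem le_sub_of_excitation {σ κ η Q N t : ℝ} (hκ : 0 < κ) (hσ : σ ≤ κ / 2) (ht : 0 ≤ t)
    (hη : 0 ≤ η) (hQ : Q ≤ 2 * N + η / 8 * t) (hQt : η / 2 * t < Q) :
    κ * η / 16 * t ≤ κ * N - σ / 2 * Q := by
  have hQ0 : 0 ≤ Q := le_trans (by positivity) hQt.le
  have e1 : κ * Q ≤ κ * (2 * N + η / 8 * t) := by gcongr
  have e2 : σ * Q ≤ κ / 2 * Q := by gcongr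
  have e3 : κ * (η / 2 * t) < κ * Q := by gcongr
  linarith

/-- For a fixed direction, the event that the noise dominates the excitation is exponentially
unlikely. -/
theorem IsClosedLoop.exists_deviation_bound [IsProbabilityMeasure P]
    (hmeas : sys.BorelMappings) (hγ : 0 < γ) (hnoise : sys.NoiseAssumption P W S μw μs σw)
    (h : sys.IsClosedLoop W S γ ϑ₀ x₀ X U θhat) {c p : ℝ}
    (hexc : sys.GloballyExcited μw μs c p) (hc : 0 < c) (hp : 0 < p) {r : ℝ} (hr : 0 < r) :
    ∃ b ε : ℝ, 0 < b ∧ 0 < ε ∧ ∀ Λ : Param d n, (∃ i j, r ≤ |Λ i j|) → ∀ t : ℕ,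
      P {ω | ∑ s ∈ Finset.range (t + 1), ‖regress Λ (sys.ψ (X s ω) (U s ω))‖ ^ 2
        ≤ 2 * (∑ s ∈ Finset.range (t + 1),
          inner ℝ (W s ω : Vec n) (regress Λ (sys.ψ (X s ω) (U s ω)))) + ε * t}
        ≤ ENNReal.ofReal (2 * Real.exp (-(b * t))) := by
  have hη : Real.exp (-(r ^ 2 * c)) < 1 :=
    Real.exp_lt_one_iff.2 (by have := mul_pos (pow_pos hr 2) hc; linarith)
  set η := p * (1 - Real.exp (-(r ^ 2 * c))) with hηdef
  have hη0 : 0 < η := mul_pos hp (by linarith)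
  -- Small enough for the compensator `σw ^ 2 * κ ^ 2` to be at most `κ / 2`, and nonsingular for
  -- `σw = 0`.
  set κ : ℝ := 1 / (2 * (σw ^ 2 + 1)) with hκ
  have hκ0 : 0 < κ := by positivity
  have hκ1 : κ ≤ 1 := by
    rw [hκ, div_le_one (by positivity)]
    have : (0 : ℝ) ≤ σw ^ 2 := by positivity
    linarith
  have hκσ : σw ^ 2 * κ ^ 2 ≤ κ / 2 := by
    have h1 : (σw ^ 2 + 1) * κ = 1 / 2 := by rw [hκ]; field_simp
    nlinarith
  refine ⟨κ * η / 16, η / 8, by positivity, by positivity, fun Λ ⟨i, j, hΛ⟩ t => ?_⟩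
  have hz : ∀ s, Measurable fun ω => regress Λ (sys.ψ (X s ω) (U s ω)) := fun s =>
    (measurable_regress Λ).comp ((h.measurable_regressor hmeas hγ le_rfl (Nat.lt_succ_self s)).mono
      (past_le hnoise.measurable_W hnoise.measurable_S _ _) le_rfl)
  have hW : ∀ s, Measurable fun ω => (W s ω : Vec n) := fun s =>
    measurable_subtype_coe.comp (hnoise.measurable_W s)
  have ht : (0 : ℝ) ≤ t := Nat.cast_nonneg t
  have h1 := measure_exp_ge_le (P := P)
    (f := fun ω => ∑ s ∈ Finset.range t, -‖regress Λ (sys.ψ (X (s + 1) ω) (U (s + 1) ω))‖ ^ 2)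
    (Finset.measurable_sum _ fun s _ => by have := hz (s + 1); fun_prop)
    -- Half of the decay rate `η` goes into the threshold and half remains as probability.
    (h.lintegral_exp_neg_excitation_le hmeas hγ hnoise hexc hr hΛ hc t) (-(η / 2 * t))
  rw [← ENNReal.ofReal_pow (Real.exp_nonneg _), ← ENNReal.ofReal_mul (by positivity),
    ← Real.exp_nat_mul, ← Real.exp_add] at h1
  have h2 := measure_exp_ge_le (P := P)
    (f := fun ω => ∑ s ∈ Finset.range (t + 1),
      (κ * inner ℝ (W s ω : Vec n) (regress Λ (sys.ψ (X s ω) (U s ω)))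
        - σw ^ 2 * κ ^ 2 / 2 * ‖regress Λ (sys.ψ (X s ω) (U s ω))‖ ^ 2))
    (Finset.measurable_sum _ fun s _ => by have := hz s; have := hW s; fun_prop)
    (h.lintegral_exp_noise_sum_le hmeas hγ hnoise Λ κ (t + 1)) (κ * η / 16 * t)
  rw [one_mul] at h2
  refine (measure_mono (t := _ ∪ _) ?_).trans ((measure_union_le _ _).trans
    ((add_le_add h1 h2).trans ?_))
  · intro ω hω
    rw [Set.mem_ofPred_eq] at hω
    rw [Set.mem_union, Set.mem_ofPred_eq, Set.mem_ofPred_eq]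
    by_contra hcon
    rw [not_or, not_le, not_le] at hcon
    obtain ⟨hc1, hc2⟩ := hcon
    rw [Finset.sum_sub_distrib, ← Finset.mul_sum, ← Finset.mul_sum] at hc2
    rw [Finset.sum_neg_distrib] at hc1
    -- The term at time 0 carries no excitation and is dropped: `t + 1` samples contain `t` excited
    -- ones.
    have hQ := Finset.sum_range_succ' (fun s => ‖regress Λ (sys.ψ (X s ω) (U s ω))‖ ^ 2) t
    have h00 := sq_nonneg ‖regress Λ (sys.ψ (X 0 ω) (U 0 ω))‖
    exact hc2.not_ge (le_sub_of_excitation hκ0 hκσ ht hη0.le hω (by linarith))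
  · rw [← ENNReal.ofReal_add (by positivity) (by positivity), two_mul]
    refine ENNReal.ofReal_le_ofReal (add_le_add (Real.exp_le_exp.2 ?_) le_rfl)
    have : κ * (η * t) ≤ 1 * (η * t) := by gcongr
    have h3 : 0 ≤ η * t := by positivity
    nlinarith

theorem IsClosedLoop.sum_sq_regress_error_le (hγ : 0 < γ)
    (h : sys.IsClosedLoop W S γ ϑ₀ x₀ X U θhat) {t : ℕ} (ht : 1 ≤ t) (ω : Ω) {β : ℝ} (hβ : 0 ≤ β)
    (hβ1 : β ≤ 1) :
    ∑ s ∈ Finset.range t,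
        ‖regress (β • (θhat t ω - sys.θstar)) (sys.ψ (X s ω) (U s ω))‖ ^ 2
      ≤ 2 * (∑ s ∈ Finset.range t, inner ℝ (W s ω : Vec n)
          (regress (β • (θhat t ω - sys.θstar)) (sys.ψ (X s ω) (U s ω))))
        + γ * frobeniusSq sys.θstar := by
  have h1 := h.estimate_argmin t ht ω
  rw [rlsCost_eq] at h1
  have h2 : ∀ s, (X (s + 1) ω : Vec n) - sys.f (X s ω) (U s ω)
      = regress sys.θstar (sys.ψ (X s ω) (U s ω)) + (W s ω : Vec n) := by
    intro s
    rw [h.state_succ]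
    simp only [g]
    abel
  simp only [h2] at h1
  exact sum_sq_regress_le hγ (fun s => sys.ψ (X s ω) (U s ω)) (fun s => (W s ω : Vec n)) t h1 hβ hβ1

/-- The grid grows like `exp (n d κ t)`, so the union bound costs at most half of the exponent `b`.
-/
theorem card_grid_mul_exp_le {r b κ : ℝ} (hr : 0 < r) (hκ : 0 ≤ κ)
    (hb : κ * (n * d) ≤ b / 2) (t : ℕ) :
    ((grid d n r ⌈Real.exp (κ * t)⌉₊).card : ℝ) * (2 * Real.exp (-(b * t)))
      ≤ 2 * (4 * r + 3) ^ (n * d) * Real.exp (t * -(b / 2)) := by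
  have h1 : (1 : ℝ) ≤ Real.exp (κ * t) := Real.one_le_exp (by positivity)
  have h2 : (⌈Real.exp (κ * t)⌉₊ : ℝ) ≤ 2 * Real.exp (κ * t) := by
    linarith [Nat.ceil_lt_add_one (Real.exp_nonneg (κ * t))]
  have h3 : 2 * r * (⌈Real.exp (κ * t)⌉₊ : ℝ) + 3 ≤ (4 * r + 3) * Real.exp (κ * t) := by
    nlinarith
  have h4 : ((grid d n r ⌈Real.exp (κ * t)⌉₊).card : ℝ)
      ≤ (4 * r + 3) ^ (n * d) * Real.exp ((n * d : ℕ) * (κ * t)) := by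
    rw [Real.exp_nat_mul, ← mul_pow]
    exact (card_grid_le hr _).trans (pow_le_pow_left₀ (by positivity) h3 _)
  calc _ ≤ ((4 * r + 3) ^ (n * d) * Real.exp ((n * d : ℕ) * (κ * t)))
        * (2 * Real.exp (-(b * t))) := by gcongr
    _ = 2 * (4 * r + 3) ^ (n * d) * (Real.exp ((n * d : ℕ) * (κ * t)) * Real.exp (-(b * t))) := by
        ring
    _ ≤ _ := by
        rw [← Real.exp_add]
        gcongr
        push_cast
        have := mul_le_mul_of_nonneg_right hb (Nat.cast_nonneg (α := ℝ) t)
        nlinarith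

/-- The estimation error is eventually small, almost surely. -/
theorem IsClosedLoop.ae_eventually_inducedNorm_le [IsProbabilityMeasure P]
    (hmeas : sys.BorelMappings) (hγ : 0 < γ) (hnoise : sys.NoiseAssumption P W S μw μs σw)
    (hreach : sys.SubExpReachable) (hcontrol : sys.ConstrainedControls) (hbasis : sys.PolyBasis)
    (h : sys.IsClosedLoop W S γ ϑ₀ x₀ X U θhat) {c p : ℝ}
    (hexc : sys.GloballyExcited μw μs c p) (hc : 0 < c) (hp : 0 < p) {ϑbar : ℝ≥0}
    (hϑ : 0 < ϑbar) :
    ∀ᵐ ω ∂P, ∀ᶠ t in atTop, inducedNorm (θhat t ω - sys.θstar) ≤ ϑbar := by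
  set r : ℝ := ϑbar / (n * d + 1) with hrdef
  have hr : 0 < r := by have : (0 : ℝ) < ϑbar := hϑ; positivity
  obtain ⟨b, ε, hb, hε, hdev⟩ := h.exists_deviation_bound hmeas hγ hnoise hexc hc hp (half_pos hr)
  set κ : ℝ := b / (2 * (n * d + 1)) with hκdef
  have hκ : 0 < κ := by positivity
  have hκb : κ * (n * d) ≤ b / 2 := by
    have h1 : κ * (n * d + 1) = b / 2 := by rw [hκdef]; field_simp
    linarith
  -- The same `κ` serves as the growth rate of the data sums below, so mesh times sum stays bounded
  -- in `t`.
  set l : ℕ → ℕ := fun t => ⌈Real.exp (κ * t)⌉₊ with hl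
  set bad : ℕ → (Fin d → Fin n → ℤ) → Set Ω := fun t k =>
    {ω | ∑ s ∈ Finset.range (t + 1), ‖regress (gridPoint (l t) k) (sys.ψ (X s ω) (U s ω))‖ ^ 2
      ≤ 2 * (∑ s ∈ Finset.range (t + 1), inner ℝ (W s ω : Vec n)
        (regress (gridPoint (l t) k) (sys.ψ (X s ω) (U s ω)))) + ε * t} with hbad
  set K : ℕ → Finset (Fin d → Fin n → ℤ) := fun t =>
    {k ∈ grid d n r (l t) | ∃ i j, r / 2 ≤ |gridPoint (l t) k i j|} with hK
  have hPbad : ∀ t, P (⋃ k ∈ K t, bad t k)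
      ≤ ENNReal.ofReal (2 * (4 * r + 3) ^ (n * d) * Real.exp (t * -(b / 2))) := by
    intro t
    calc P (⋃ k ∈ K t, bad t k) ≤ ∑ k ∈ K t, P (bad t k) := measure_biUnion_finset_le _ _
      _ ≤ ∑ _k ∈ K t, ENNReal.ofReal (2 * Real.exp (-(b * t))) :=
          Finset.sum_le_sum fun k hk => hdev _ (Finset.mem_filter.1 hk).2 t
      _ ≤ (grid d n r (l t)).card * ENNReal.ofReal (2 * Real.exp (-(b * t))) := by
          rw [Finset.sum_const, nsmul_eq_mul]
          gcongr
          exact Finset.filter_subset _ _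
      _ ≤ _ := by
          rw [← ENNReal.ofReal_natCast, ← ENNReal.ofReal_mul (Nat.cast_nonneg _)]
          exact ENNReal.ofReal_le_ofReal (card_grid_mul_exp_le hr hκ.le hκb t)
  have hsum : ∑' t, P (⋃ k ∈ K t, bad t k) ≠ ⊤ := by
    refine ne_top_of_le_ne_top ?_ (ENNReal.tsum_le_tsum hPbad)
    exact ((Real.summable_exp_nat_mul_iff.2 (by linarith)).mul_left _).tsum_ofReal_ne_top
  have hWlin := hnoise.ae_exists_linear_bound (σ := id) continuous_id (B := 1) fun r => by
    rw [one_mul]; exact (lt_add_one _).le.trans (Real.add_one_le_exp _)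
  filter_upwards [ae_eventually_notMem hsum,
    h.ae_subExpGrowth_regressor hnoise hreach hcontrol hbasis, hWlin] with ω hω hψ ⟨Kw, hKw⟩
  have hWg : SubExpGrowth fun t => ‖(W t ω : Vec n)‖ := by
    refine ((SubExpGrowth.const (Kw : ℝ)).mul (SubExpGrowth.natCast.add (.const 1))
      fun t => by positivity).mono fun t => ?_
    have := hKw t
    simp only [id] at this
    exact_mod_cast this
  obtain ⟨B, hB, hBle⟩ := (((hψ.pow (fun t => norm_nonneg _) 2).add
    (hWg.mul hψ fun t => norm_nonneg _)).sum) κ hκ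
  set C : ℝ := ((d : ℝ) * n) ^ 2 * (2 * r + 1) + 2 * (d * n) with hC
  have hC0 : 0 ≤ C := by positivity
  set R : ℝ := γ * frobeniusSq sys.θstar + C * (B * Real.exp κ) with hR
  have htop : Tendsto (fun t : ℕ => (t : ℝ)) atTop atTop := tendsto_natCast_atTop_atTop
  -- The estimate at `t + 1` fits `t + 1` samples, matching the sums in the bad events.
  suffices hs : ∀ᶠ t in atTop, inducedNorm (θhat (t + 1) ω - sys.θstar) ≤ ϑbar by
    obtain ⟨T, hT⟩ := eventually_atTop.1 hs
    refine eventually_atTop.2 ⟨T + 1, fun t ht => ?_⟩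
    have := hT (t - 1) (by omega)
    rwa [Nat.sub_add_cancel (by omega)] at this
  filter_upwards [hω, htop.eventually_ge_atTop (R / ε), htop.eventually_ge_atTop (2 / (r * κ))]
    with t hωt hRt hrt
  by_contra hcon
  have hl1 : Real.exp (κ * t) ≤ l t := Nat.le_ceil _
  have hl0 : (0 : ℝ) < l t := (Real.exp_pos _).trans_le hl1
  have hl2 : 2 ≤ r * l t := by
    rw [div_le_iff₀ (by positivity)] at hrt
    have h1 : κ * t ≤ l t := by linarith [Real.add_one_le_exp (κ * t)]
    calc 2 ≤ r * (κ * t) := by linarith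
      _ ≤ _ := by gcongr
  obtain ⟨i₀, j₀, hE⟩ : ∃ i j, r ≤ |(θhat (t + 1) ω - sys.θstar) i j| := by
    by_contra hall
    push Not at hall
    refine hcon (NNReal.coe_le_coe.1 ((inducedNorm_le hr.le fun i j => (hall i j).le).trans ?_))
    have h1 : r * (n * d + 1) = ϑbar := by rw [hrdef]; field_simp
    linarith
  obtain ⟨β, hβ0, hβ1, k, hk, hkr, hclose⟩ := exists_grid_point hr hl2 hE
  -- A large error at this time would make its grid point bad: regularisation and rounding together
  -- cost at most `R`, and `R ≤ ε * t`.
  refine hωt (Set.mem_biUnion (Finset.mem_filter.2 ⟨hk, hkr⟩) ?_)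
  have h1 := h.sum_sq_regress_error_le hγ (Nat.le_add_left 1 t) ω hβ0 hβ1
  have hh1 : 1 / (l t : ℝ) ≤ 1 := by
    rw [div_le_one hl0]
    exact (Real.one_le_exp (by positivity)).trans hl1
  have h2 := sum_sq_sub_two_inner_le (fun s => sys.ψ (X s ω) (U s ω)) (fun s => (W s ω : Vec n))
    (t + 1) hr.le (by positivity) hh1 (fun i j => (hclose i j).1) (fun i j => (hclose i j).2)
  have h3 := hBle (t + 1)
  have h4 : 1 / (l t : ℝ) * (C * ∑ s ∈ Finset.range (t + 1), (‖sys.ψ (X s ω) (U s ω)‖ ^ 2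
      + ‖(W s ω : Vec n)‖ * ‖sys.ψ (X s ω) (U s ω)‖)) ≤ C * (B * Real.exp κ) := by
    calc _ ≤ 1 / (l t : ℝ) * (C * (B * Real.exp (κ * (t + 1 : ℕ)))) := by gcongr
      _ = C * (B * Real.exp κ) * (Real.exp (κ * t) / l t) := by
          push_cast
          rw [mul_add, mul_one, Real.exp_add]
          ring
      _ ≤ C * (B * Real.exp κ) * 1 := by
          gcongr
          exact (div_le_one hl0).2 hl1
      _ = _ := mul_one _
  have h5 : R ≤ ε * t := by rwa [div_le_iff₀ hε, mul_comm] at hRt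
  simp only [hbad, Set.mem_ofPred_eq]
  linarith

end System

/-! ### The Lyapunov argument -/

theorem ClassKInf.exists_ge {a : ℝ≥0 → ℝ≥0} (h : ClassKInf a) (K : ℝ≥0) : ∃ r, K ≤ a r :=
  (h.unbounded.eventually_ge_atTop K).exists

theorem ClassKInf.surjective {a : ℝ≥0 → ℝ≥0} (h : ClassKInf a) : Function.Surjective a := by
  intro y
  obtain ⟨r, hr⟩ := h.exists_ge y
  have h1 := intermediate_value_Icc (zero_le (a := r)) h.continuous.continuousOn
  obtain ⟨x, -, hx⟩ := h1 ⟨by rw [h.map_zero]; exact zero_le, hr⟩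
  exact ⟨x, hx⟩

/-- Convexity and `a 0 = 0` give slope at least `a 1` beyond 1; on the unit interval the additive
`c` suffices. -/
theorem ClassKInf.exists_linear_le {a : ℝ≥0 → ℝ≥0} (h : ClassKInf a)
    (hconv : ConvexOn ℝ≥0 Set.univ a) :
    ∃ c : ℝ≥0, 0 < c ∧ c < 1 ∧ ∀ v, c * v ≤ a v + c := by
  have h1 : 0 < a 1 := by
    have := h.strictMono one_pos
    rwa [h.map_zero] at this
  refine ⟨min (a 1) 2⁻¹, by positivity,
    (min_le_right _ _).trans_lt (by rw [← NNReal.coe_lt_coe]; push_cast; norm_num), fun v => ?_⟩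
  rcases le_total v 1 with hv | hv
  · exact (mul_le_of_le_one_right' hv).trans (le_add_of_nonneg_left zero_le)
  · have hv0 : 0 < v := one_pos.trans_le hv
    have h2 := hconv.2 (Set.mem_univ v) (Set.mem_univ 0)
      (zero_le : 0 ≤ v⁻¹) (zero_le : 0 ≤ 1 - v⁻¹) (add_tsub_cancel_of_le (inv_le_one_of_one_le₀ hv))
    simp only [smul_eq_mul, mul_zero, add_zero, h.map_zero, inv_mul_cancel₀ hv0.ne'] at h2
    have h3 : a 1 * v ≤ a v := by
      calc a 1 * v ≤ (v⁻¹ * a v) * v := by gcongr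
        _ = a v := by field_simp
    calc min (a 1) 2⁻¹ * v ≤ a 1 * v := by gcongr; exact min_le_left _ _
      _ ≤ a v := h3
      _ ≤ _ := le_add_of_nonneg_right zero_le

namespace System

variable {n m d q : ℕ} {sys : System n m d q} {Ω : Type*} {mΩ : MeasurableSpace Ω} {P : Measure Ω}
  {W : ℕ → Ω → sys.𝕎} {S : ℕ → Ω → sys.𝕊} {μw : Measure sys.𝕎} {μs : Measure sys.𝕊} {σw : ℝ≥0}
  {γ : ℝ} {ϑ₀ : Param d n} {x₀ : sys.𝕏}
  {X : ℕ → Ω → sys.𝕏} {U : ℕ → Ω → sys.𝕌} {θhat : ℕ → Ω → Param d n}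

theorem GlobalStochasticLyapunov.measurable {V : sys.𝕏 → ℝ≥0} {ϑbar : ℝ≥0}
    (h : sys.GlobalStochasticLyapunov μw μs V ϑbar) : Measurable V :=
  h.1.comp (measurable_id.subtype_mk (h := fun _ => Set.mem_univ _))

/-- A global stochastic Lyapunov function satisfies a geometric drift condition. -/
theorem GlobalStochasticLyapunov.exists_drift {V : sys.𝕏 → ℝ≥0} {ϑbar : ℝ≥0}
    (h : sys.GlobalStochasticLyapunov μw μs V ϑbar) :
    ∃ ρ D : ℝ≥0, ρ < 1 ∧ ∀ (x : sys.𝕏) (ϑ : Param d n), inducedNorm (ϑ - sys.θstar) ≤ ϑbar →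
      ∫⁻ sw, (V (sys.g x (sys.α x sw.1 ϑ) sw.2) : ENNReal) ∂(μs.prod μw) ≤ ρ * V x + D := by
  obtain ⟨-, -, α₁, α₂, α₃, σ₃, dtil, -, h2, h3, hσ, hV, hdiff, αv, hαv, hconv, hle⟩ := h
  obtain ⟨c, hc0, hc1, hc⟩ := hαv.exists_linear_le hconv
  refine ⟨1 - c, c + dtil + σ₃ ϑbar, tsub_lt_self one_pos hc0, fun x ϑ hϑ => ?_⟩
  obtain ⟨hint, hd⟩ := hdiff x (Set.mem_univ x) (ϑ - sys.θstar) hϑ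
  have e0 : ∀ sw, sys.nextV V x (ϑ - sys.θstar) sw = V (sys.g x (sys.α x sw.1 ϑ) sw.2) := by
    intro sw; simp [nextV]
  have e1 : ∫⁻ sw, (V (sys.g x (sys.α x sw.1 ϑ) sw.2) : ENNReal) ∂(μs.prod μw)
      = ENNReal.ofReal (∫ sw, sys.nextV V x (ϑ - sys.θstar) sw ∂(μs.prod μw)) := by
    rw [ofReal_integral_eq_lintegral_ofReal hint (ae_of_all _ fun sw => NNReal.coe_nonneg _)]
    simp only [e0, ENNReal.ofReal_coe_nnreal]
  -- `α₂` is onto, so `Function.invFun` is a true inverse and the upper bound on `V` can be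
  -- inverted.
  have e2 : αv (V x) ≤ α₃ ‖(x : Vec n)‖₊ := by
    refine (hle _).trans (h3.strictMono.monotone ?_)
    refine h2.strictMono.le_iff_le.1 ?_
    rw [Function.invFun_eq (h2.surjective (V x))]
    exact (hV x (Set.mem_univ x)).2
  have e3 : (c : ℝ) * V x ≤ α₃ ‖(x : Vec n)‖₊ + c := by
    exact_mod_cast (hc (V x)).trans (by gcongr)
  have e4 : (σ₃ (inducedNorm (ϑ - sys.θstar)) : ℝ) ≤ σ₃ ϑbar := by
    exact_mod_cast hσ.strictMono.monotone hϑ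
  rw [e1]
  refine (ENNReal.ofReal_le_ofReal (q := ((((1 - c) * V x + (c + dtil + σ₃ ϑbar) : ℝ≥0)) : ℝ))
    ?_).trans_eq ?_
  · unfold lyapunovDiff at hd
    rw [NNReal.coe_add, NNReal.coe_mul, NNReal.coe_sub hc1.le]
    push_cast
    linarith
  · rw [ENNReal.ofReal_coe_nnreal]
    push_cast
    rfl

theorem IsClosedLoop.measurableSet_good (hmeas : sys.BorelMappings) (hγ : 0 < γ)
    (h : sys.IsClosedLoop W S γ ϑ₀ x₀ X U θhat) {V : sys.𝕏 → ℝ≥0} (hV : Measurable V)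
    {ϑbar M : ℝ≥0} {T k t : ℕ} (hT : T + 1 ≤ t) (hk : T + k ≤ t) :
    MeasurableSet[past W S t t] {ω | V (X (T + 1) ω) ≤ M ∧ ∀ u, T ≤ u → u < T + k →
        inducedNorm (θhat u ω - sys.θstar) ≤ ϑbar} := by
  have h1 : MeasurableSet[past W S t t] {ω | V (X (T + 1) ω) ≤ M} := by
    have hM : MeasurableSet {x : sys.𝕏 | V x ≤ M} := measurableSet_le hV measurable_const
    exact h.measurable_state hmeas hγ hT hT hM
  have h2 : ∀ u < T + k, MeasurableSet[past W S t t]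
      {ω | inducedNorm (θhat u ω - sys.θstar) ≤ ϑbar} := by
    intro u hu
    have hM : MeasurableSet {a : Fin d → Fin n → ℝ |
        inducedNorm (Matrix.of a - sys.θstar) ≤ ϑbar} :=
      measurableSet_le (measurable_inducedNorm sys.θstar) measurable_const
    exact h.measurable_estimate hmeas hγ (t := u) (by omega) (by omega) hM
  have h3 : {ω | V (X (T + 1) ω) ≤ M ∧ ∀ u, T ≤ u → u < T + k →
        inducedNorm (θhat u ω - sys.θstar) ≤ ϑbar}
      = {ω | V (X (T + 1) ω) ≤ M} ∩ ⋂ u, ⋂ (_ : T ≤ u), ⋂ (_ : u < T + k),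
      {ω | inducedNorm (θhat u ω - sys.θstar) ≤ ϑbar} := by
    ext ω; simp
  rw [h3]
  exact h1.inter (MeasurableSet.iInter fun u => MeasurableSet.iInter fun _ =>
    MeasurableSet.iInter fun hu => h2 u hu)

/-- The indicator is known before the next noise and decreases in `k`, so the drift iterates on it
with nothing required of `V` elsewhere. The constant `D / (1 - ρ)` is the fixed point of `v ↦ ρ v +
D`. -/
theorem IsClosedLoop.lintegral_indicator_lyapunov_le [IsProbabilityMeasure P]
    (hmeas : sys.BorelMappings) (hγ : 0 < γ) (hnoise : sys.NoiseAssumption P W S μw μs σw)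
    (h : sys.IsClosedLoop W S γ ϑ₀ x₀ X U θhat) {V : sys.𝕏 → ℝ≥0} (hV : Measurable V)
    {ϑbar ρ D : ℝ≥0} (hρ : ρ < 1)
    (hdrift : ∀ (x : sys.𝕏) (ϑ : Param d n), inducedNorm (ϑ - sys.θstar) ≤ ϑbar →
      ∫⁻ sw, (V (sys.g x (sys.α x sw.1 ϑ) sw.2) : ENNReal) ∂(μs.prod μw) ≤ ρ * V x + D)
    (T : ℕ) (M : ℝ≥0) (k : ℕ) :
    ∫⁻ ω, {ω | V (X (T + 1) ω) ≤ M ∧ ∀ u, T ≤ u → u < T + k →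
        inducedNorm (θhat u ω - sys.θstar) ≤ ϑbar}.indicator 1 ω * (V (X (T + 1 + k) ω) : ENNReal) ∂P
      ≤ ρ ^ k * M + (D / (1 - ρ) : ℝ≥0) := by
  set G : ℕ → Set Ω := fun k => {ω | V (X (T + 1) ω) ≤ M ∧ ∀ u, T ≤ u → u < T + k →
        inducedNorm (θhat u ω - sys.θstar) ≤ ϑbar} with hG
  have hD : ρ * (D / (1 - ρ)) + D = D / (1 - ρ) := by
    have h1 : 1 - ρ ≠ 0 := (tsub_pos_of_lt hρ).ne'
    have h2 : ρ + (1 - ρ) = 1 := add_tsub_cancel_of_le hρ.le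
    have h3 : D / (1 - ρ) * (1 - ρ) = D := div_mul_cancel₀ _ h1
    calc ρ * (D / (1 - ρ)) + D = ρ * (D / (1 - ρ)) + D / (1 - ρ) * (1 - ρ) := by rw [h3]
      _ = D / (1 - ρ) * (ρ + (1 - ρ)) := by ring
      _ = _ := by rw [h2, mul_one]
  induction k with
  | zero =>
    calc _ ≤ ∫⁻ _ω, (M : ENNReal) ∂P := by
          refine lintegral_mono fun ω => ?_
          by_cases hω : ω ∈ G 0
          · rw [Set.indicator_of_mem hω, Pi.one_apply, one_mul]
            exact ENNReal.coe_le_coe.2 hω.1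
          · rw [Set.indicator_of_notMem hω, zero_mul]
            exact zero_le
      _ ≤ _ := by simp
  | succ k ih =>
    set t := T + 1 + k with ht
    have hGmeas : MeasurableSet[past W S t t] (G (k + 1)) :=
      h.measurableSet_good hmeas hγ hV (by omega) (by omega)
    have hYm : Measurable[past W S t t] ((G (k + 1)).indicator (1 : Ω → ENNReal)) :=
      (measurable_indicator_const_iff (1 : ENNReal)).2 hGmeas
    have hA : Measurable[past W S t t] fun ω =>
        (X t ω, (fun i j => θhat (T + k) ω i j : Fin d → Fin n → ℝ)) :=
      (h.measurable_state hmeas hγ le_rfl le_rfl).prodMk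
        (h.measurable_estimate hmeas hγ (by omega) (by omega))
    have hF : Measurable fun a : (sys.𝕏 × (Fin d → Fin n → ℝ)) × (sys.𝕊 × sys.𝕎) =>
        (V (sys.g a.1.1 (sys.α a.1.1 a.2.1 (Matrix.of a.1.2)) a.2.2) : ENNReal) := by
      have h1 : Measurable fun a : (sys.𝕏 × (Fin d → Fin n → ℝ)) × (sys.𝕊 × sys.𝕎) =>
          sys.α a.1.1 a.2.1 (Matrix.of a.1.2) := hmeas.α.comp
        ((measurable_fst.comp measurable_fst).prodMk
          ((measurable_fst.comp measurable_snd).prodMk (measurable_snd.comp measurable_fst)))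
      exact (hV.comp (hmeas.measurable_g.comp (((measurable_fst.comp measurable_fst).prodMk h1).prodMk
        (measurable_snd.comp measurable_snd)))).coe_nnreal_ennreal
    have h1 := lintegral_mul_of_indep (P := P)
      (past_le hnoise.measurable_W hnoise.measurable_S t t) hYm hA
      ((hnoise.measurable_S t).prodMk (hnoise.measurable_W t))
      (indep_past_pair hnoise.measurable_W hnoise.measurable_S hnoise.iIndep_noiseSigma le_rfl
        le_rfl) hF
    rw [map_pair hnoise.measurable_W hnoise.measurable_S hnoise.iIndep_noiseSigma, hnoise.law_S,
      hnoise.law_W] at h1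
    have h2 : ∀ ω, X (T + 1 + (k + 1)) ω
        = sys.g (X t ω) (sys.α (X t ω) (S t ω) (θhat (T + k) ω)) (W t ω) := by
      intro ω
      have e1 : T + 1 + (k + 1) = t + 1 := by omega
      -- The control at `t` uses the estimate at `T + k`, the last one constrained by `G (k + 1)`.
      have e2 : t = (T + k) + 1 := by omega
      rw [e1, h.state_succ, e2, h.control_succ]
    have hGm : ∀ ω, (G (k + 1)).indicator (1 : Ω → ENNReal) ω ≤ (G k).indicator 1 ω := fun ω =>
      Set.indicator_le_indicator_of_subset
        (show G (k + 1) ⊆ G k from fun ω hω => ⟨hω.1, fun u hu hu' => hω.2 u hu (by omega)⟩) (fun _ => zero_le) ω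
    have hm1 : Measurable fun ω => (D : ENNReal) * (G (k + 1)).indicator (1 : Ω → ENNReal) ω :=
      (hYm.mono (past_le hnoise.measurable_W hnoise.measurable_S t t) le_rfl).const_mul _
    simp only [h2]
    refine h1.trans_le ?_
    calc _ ≤ ∫⁻ ω, (ρ * ((G k).indicator 1 ω * (V (X t ω) : ENNReal))
          + D * (G (k + 1)).indicator 1 ω) ∂P := by
          refine lintegral_mono fun ω => ?_
          by_cases hω : ω ∈ G (k + 1)
          · have hω' : ω ∈ G k := ⟨hω.1, fun u hu hu' => hω.2 u hu (by omega)⟩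
            simp only [Set.indicator_of_mem hω, Set.indicator_of_mem hω', Pi.one_apply, one_mul,
              mul_one]
            exact hdrift _ _ (hω.2 (T + k) (by omega) (by omega))
          · simp only [Set.indicator_of_notMem hω, zero_mul]
            exact zero_le
      _ = ρ * ∫⁻ ω, (G k).indicator 1 ω * (V (X t ω) : ENNReal) ∂P
          + D * ∫⁻ ω, (G (k + 1)).indicator 1 ω ∂P := by
          rw [lintegral_add_right _ hm1, lintegral_const_mul' _ _ ENNReal.coe_ne_top,
            lintegral_const_mul' _ _ ENNReal.coe_ne_top]
      _ ≤ ρ * (ρ ^ k * M + (D / (1 - ρ) : ℝ≥0)) + D * 1 := by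
          gcongr
          calc ∫⁻ ω, (G (k + 1)).indicator 1 ω ∂P ≤ ∫⁻ _ω, 1 ∂P :=
                lintegral_mono fun ω => Set.indicator_le_self' (fun _ _ => zero_le) ω
            _ = 1 := by simp
      _ = ρ ^ (k + 1) * M + ((ρ * (D / (1 - ρ)) + D : ℝ≥0) : ENNReal) := by
          push_cast
          ring
      _ = _ := by rw [hD]

/-- For large times, the state is bounded with high probability, uniformly over the initial
states. -/
theorem exists_eventual_bound [IsProbabilityMeasure P]
    (hmeas : sys.BorelMappings) (hγ : 0 < γ) (hnoise : sys.NoiseAssumption P W S μw μs σw)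
    (hreach : sys.SubExpReachable) (hcontrol : sys.ConstrainedControls) (hbasis : sys.PolyBasis)
    {c p : ℝ} (hexc : sys.GloballyExcited μw μs c p) (hc : 0 < c) (hp : 0 < p)
    {V : sys.𝕏 → ℝ≥0} {ϑbar : ℝ≥0} (hϑ : 0 < ϑbar)
    (hlyap : sys.GlobalStochasticLyapunov μw μs V ϑbar) {δ : ℝ≥0} (hδ : 0 < δ) :
    ∃ c₂ : ℝ≥0, ∀ (x₀ : sys.𝕏) (X : ℕ → Ω → sys.𝕏) (U : ℕ → Ω → sys.𝕌)
      (θhat : ℕ → Ω → Param d n), sys.IsClosedLoop W S γ ϑ₀ x₀ X U θhat →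
      ∃ T, ∀ t, T ≤ t → P {ω | c₂ < ‖(X t ω : Vec n)‖₊} ≤ δ := by
  obtain ⟨ρ, D, hρ, hdrift⟩ := hlyap.exists_drift
  have hV := hlyap.measurable
  obtain ⟨-, -, α₁, α₂, α₃, σ₃, dtil, h1, -, -, -, hVle, -⟩ := hlyap
  -- The 1 leaves room for the transient `ρ ^ k * M`. Neither `L` nor `c₂` depends on the initial
  -- state; only `T`, `M` and `k₀` do.
  set L : ℝ≥0 := 1 + D / (1 - ρ) with hL
  have hL0 : 0 < L := by positivity
  set K : ℝ≥0 := L / (δ / 2) with hK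
  have hK0 : 0 < K := by positivity
  obtain ⟨c₂, hc₂⟩ := h1.exists_ge K
  refine ⟨c₂, fun x₀ X U θhat h => ?_⟩
  have hle := past_le hnoise.measurable_W hnoise.measurable_S
  have hδ4 : ((δ / 4 : ℝ≥0) : ENNReal) ≠ 0 := by
    have : δ / 4 ≠ 0 := by positivity
    exact_mod_cast this
  obtain ⟨T, hT⟩ := exists_measure_not_forall_ge_le (P := P)
    (p := fun t ω => inducedNorm (θhat t ω - sys.θstar) ≤ ϑbar)
    (fun t => by
      have hM : MeasurableSet {a : Fin d → Fin n → ℝ |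
          inducedNorm (Matrix.of a - sys.θstar) ≤ ϑbar} :=
        measurableSet_le (measurable_inducedNorm sys.θstar) measurable_const
      exact (h.measurable_estimate hmeas hγ le_rfl le_rfl).mono (hle t t) le_rfl hM)
    (h.ae_eventually_inducedNorm_le hmeas hγ hnoise hreach hcontrol hbasis hexc hc hp hϑ) hδ4
  obtain ⟨M, hM⟩ := exists_measure_gt_le (P := P) (f := fun ω => V (X (T + 1) ω))
    (hV.comp ((h.measurable_state hmeas hγ le_rfl le_rfl).mono (hle _ _) le_rfl)) hδ4
  have hlim : Tendsto (fun k : ℕ => ρ ^ k * M) atTop (𝓝 0) := by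
    simpa using (tendsto_pow_atTop_nhds_zero_of_lt_one (zero_le) hρ).mul_const M
  obtain ⟨k₀, hk₀⟩ := eventually_atTop.1 (hlim.eventually (ge_mem_nhds one_pos))
  refine ⟨T + 1 + k₀, fun t ht => ?_⟩
  obtain ⟨k, rfl⟩ := Nat.exists_eq_add_of_le (show T + 1 ≤ t by omega)
  have hk := hk₀ k (by omega)
  have hI := h.lintegral_indicator_lyapunov_le hmeas hγ hnoise hV hρ hdrift T M k
  set G : Set Ω := {ω | V (X (T + 1) ω) ≤ M ∧ ∀ u, T ≤ u → u < T + k →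
        inducedNorm (θhat u ω - sys.θstar) ≤ ϑbar} with hG
  have hI' : ∫⁻ ω, G.indicator 1 ω * (V (X (T + 1 + k) ω) : ENNReal) ∂P ≤ L := by
    refine hI.trans ?_
    rw [hL]
    exact_mod_cast add_le_add_left hk _
  have hmk : P {ω | (K : ENNReal) ≤ G.indicator 1 ω * (V (X (T + 1 + k) ω) : ENNReal)}
      ≤ (δ / 2 : ℝ≥0) := by
    have h2 := meas_ge_le_lintegral_div (μ := P) (f := fun ω => G.indicator 1 ω *
      (V (X (T + 1 + k) ω) : ENNReal)) (ε := K) ?_ (by exact_mod_cast hK0.ne') ENNReal.coe_ne_top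
    · refine h2.trans ((ENNReal.div_le_div_right hI' _).trans_eq ?_)
      rw [← ENNReal.coe_div hK0.ne', hK, div_div_cancel₀ hL0.ne']
    · have hGm : MeasurableSet G :=
        hle _ _ _ (h.measurableSet_good hmeas hγ hV (t := T + 1 + k) (by omega) (by omega))
      have hXm : Measurable (X (T + 1 + k)) :=
        (h.measurable_state hmeas hγ le_rfl le_rfl).mono (hle _ _) le_rfl
      exact ((measurable_one.indicator hGm).mul (hV.comp hXm).coe_nnreal_ennreal).aemeasurable
  have hsub : {ω | c₂ < ‖(X (T + 1 + k) ω : Vec n)‖₊} ⊆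
      ({ω | M < V (X (T + 1) ω)} ∪ {ω | ¬ ∀ t, T ≤ t → inducedNorm (θhat t ω - sys.θstar) ≤ ϑbar})
        ∪ {ω | (K : ENNReal) ≤ G.indicator 1 ω * (V (X (T + 1 + k) ω) : ENNReal)} := by
    intro ω hω
    by_contra hcon
    simp only [Set.mem_union, Set.mem_ofPred_eq, not_or, not_lt, not_not] at hcon
    obtain ⟨⟨hc1, hc2⟩, hc3⟩ := hcon
    have hωG : ω ∈ G := ⟨hc1, fun u hu _ => hc2 u hu⟩
    rw [Set.indicator_of_mem hωG, Pi.one_apply, one_mul] at hc3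
    refine hc3 ?_
    have h3 : K ≤ V (X (T + 1 + k) ω) :=
      (hc₂.trans (h1.strictMono.monotone (le_of_lt hω))).trans (hVle _ (Set.mem_univ _)).1
    exact_mod_cast h3
  -- Failure budget: `δ / 4` for a large `V` at `T + 1`, `δ / 4` for a late bad estimate, `δ / 2`
  -- for Markov's inequality.
  calc _ ≤ _ := measure_mono hsub
    _ ≤ _ := (measure_union_le _ _).trans (add_le_add (measure_union_le _ _) le_rfl)
    _ ≤ ((δ / 4 : ℝ≥0) + (δ / 4 : ℝ≥0)) + (δ / 2 : ℝ≥0) := add_le_add (add_le_add hM hT) hmk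
    _ = δ := by
      rw [← ENNReal.coe_add, ← ENNReal.coe_add]
      congr 1
      ext
      push_cast
      ring

end System

end AdaptiveStabilisation

/-! ### The stability bound -/

open AdaptiveStabilisation in
theorem corollary1 {n m d q : ℕ} (sys : System n m d q)
    {Ω : Type*} [MeasurableSpace Ω] (P : Measure Ω) [IsProbabilityMeasure P]
    (W : ℕ → Ω → sys.𝕎) (S : ℕ → Ω → sys.𝕊)
    (μw : Measure sys.𝕎) (μs : Measure sys.𝕊) (σw : ℝ≥0)
    (γ : ℝ) (hγ : 0 < γ) (ϑ₀ : Param d n)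
    (hmeas : sys.BorelMappings)
    (hnoise : sys.NoiseAssumption P W S μw μs σw)
    (hreach : sys.SubExpReachable)
    (hcontrol : sys.ConstrainedControls)
    (hbasis : sys.PolyBasis)
    (hexc : ∃ c p : ℝ, 0 < c ∧ 0 < p ∧ sys.GloballyExcited μw μs c p)
    (hlyap : ∃ (V : sys.𝕏 → ℝ≥0) (ϑbar : ℝ≥0), 0 < ϑbar ∧
      sys.GlobalStochasticLyapunov μw μs V ϑbar) :
    ∀ δ : ℝ, 0 < δ → δ < 1 → ∃ c₂ : ℝ≥0, ∀ x₀ : sys.𝕏, ∃ η : ℕ → ℝ≥0, ClassL η ∧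
      ∀ (X : ℕ → Ω → sys.𝕏) (U : ℕ → Ω → sys.𝕌) (θhat : ℕ → Ω → Param d n),
        sys.IsClosedLoop W S γ ϑ₀ x₀ X U θhat →
        ∀ t : ℕ, 1 - δ ≤ P.real {ω | ‖(X t ω : Vec n)‖ ≤ η t + c₂} := by
  intro δ hδ _
  obtain ⟨c, p, hc, hp, hexc⟩ := hexc
  obtain ⟨V, ϑbar, hϑ, hlyap⟩ := hlyap
  lift δ to ℝ≥0 using hδ.le
  have hδ' : 0 < δ := hδ
  obtain ⟨c₂, hc₂⟩ := System.exists_eventual_bound (ϑ₀ := ϑ₀) hmeas hγ hnoise hreach hcontrol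
    hbasis hexc hc hp hϑ hlyap hδ'
  refine ⟨c₂, fun x₀ => ?_⟩
  -- `η` must precede the closed loop, so it is built from one chosen loop; if none exists, any `η`
  -- works.
  by_cases hex : ∃ X U θhat, sys.IsClosedLoop W S γ ϑ₀ x₀ X U θhat
  · obtain ⟨X, U, θhat, h⟩ := hex
    obtain ⟨T, hT⟩ := hc₂ x₀ X U θhat h
    have hXm : ∀ t, Measurable fun ω => ‖(X t ω : Vec n)‖₊ := fun t =>
      measurable_nnnorm.comp (measurable_subtype_coe.comp
        ((h.measurable_state hmeas hγ le_rfl le_rfl).mono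
          (past_le hnoise.measurable_W hnoise.measurable_S t t) le_rfl))
    have htight : ∀ t, ∃ R : ℝ≥0, P {ω | R < ‖(X t ω : Vec n)‖₊} ≤ δ := fun t =>
      exists_measure_gt_le (hXm t) (by exact_mod_cast hδ'.ne')
    choose R hR using htight
    -- A step function: before `T` it exceeds every tightness radius `R t`, afterwards `c₂` alone is
    -- enough.
    refine ⟨fun t => if t < T then ∑ s ∈ Finset.range T, R s else 0, ⟨?_, ?_⟩, ?_⟩
    · intro s t hst
      by_cases ht : t < T
      · simp [ht, lt_of_le_of_lt hst ht]
      · simp [ht]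
    · refine tendsto_const_nhds.congr' ?_
      filter_upwards [eventually_ge_atTop T] with t ht
      simp [not_lt.2 ht]
    · intro X' U' θhat' h' t
      have hX : ∀ ω, X' t ω = X t ω := fun ω => (h'.unique hγ h t ω).1
      simp only [hX]
      set r : ℝ≥0 := (if t < T then ∑ s ∈ Finset.range T, R s else 0) + c₂ with hr
      have hP : P {ω | r < ‖(X t ω : Vec n)‖₊} ≤ δ := by
        by_cases ht : t < T
        · refine (measure_mono fun ω (hω : r < _) => ?_).trans (hR t)
          refine lt_of_le_of_lt ?_ hω
          rw [hr, if_pos ht]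
          exact (Finset.single_le_sum (fun _ _ => zero_le) (Finset.mem_range.2 ht)).trans
            (le_add_of_nonneg_right zero_le)
        · refine (measure_mono fun ω (hω : r < _) => ?_).trans (hT t (not_lt.1 ht))
          refine lt_of_le_of_lt ?_ hω
          rw [hr]
          exact le_add_of_nonneg_left zero_le
      have hset : {ω | ‖(X t ω : Vec n)‖ ≤ ((if t < T then ∑ s ∈ Finset.range T, R s else 0 : ℝ≥0) : ℝ)
          + c₂} = {ω | r < ‖(X t ω : Vec n)‖₊}ᶜ := by
        ext ω
        rw [Set.mem_compl_iff, Set.mem_ofPred_eq, Set.mem_ofPred_eq, not_lt, ← NNReal.coe_le_coe,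
          hr, NNReal.coe_add, coe_nnnorm]
      rw [hset, probReal_compl_eq_one_sub (measurableSet_lt measurable_const (hXm t))]
      have hP' : P.real {ω | r < ‖(X t ω : Vec n)‖₊} ≤ δ := by
        have := ENNReal.toReal_mono ENNReal.coe_ne_top hP
        simpa [Measure.real] using this
      linarith
  · refine ⟨fun _ => 0, ⟨antitone_const, tendsto_const_nhds⟩, fun X U θhat h => ?_⟩
    exact absurd ⟨X, U, θhat, h⟩ hex
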